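/- Let $V$ be a finite set. A simplicial complex $X$ on $V$ is a family of subsets of $V$ (the faces) closed under taking subsets; its facets are its inclusion-maximal faces. For $\sigma\subseteq V$ let $\Delta(\sigma)=2^{\sigma}$; a complex is called a simplex if it equals $\Delta(\sigma)$ for some, possibly empty, $\sigma$. Let $\partial\Delta(n)$ be the complex of all proper subsets of an $n$-element set. For $W\subseteq V$ let $X[W]=\{F\in X: F\subseteq W\}$ be the induced subcomplex. Let $\tilde H_n$ denote reduced simplicial homology with coefficients in $\mathbb Z/2$, for $n\ge 0$, and $\tilde\beta_n=\dim_{\mathbb Z/2}\tilde H_n$. The Leray number $L(X)$ is the least integer $d\ge 0$ such that $\tilde H_i(X[W])=0$ for all $i\ge d$ and all $W\subseteq V$. Let $\prec:\sigma_1\prec\dots\prec\sigma_m$ be a linear order of the facets of $X$ and put $X_j=\bigcup_{i\le j}\Delta(\sigma_i)$. Define $M_\prec(X)=1+\#\{\,2\le j\le m : X_{j-1}\cap\Delta(\sigma_j)\text{ is not a simplex}\,\}$, and let $M(X)$ be the minimum of $M_\prec(X)$ over all linear orders $\prec$ of the facets. The order $\prec$ is a weak shelling of $X$ if for every $j=2,\dots,m$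 there is a vertex $u_j$ such that $X_{j-1}[\sigma_j\setminus\{u_j\}]$ is a simplex. **Theorem.** Let $X$ be a non-empty simplicial complex on $V$ (i.e. with at least one face) such that $L(X)=M(X)$, and suppose that $X$ has a weak shelling $\prec$ with $M_\prec(X)=M(X)$. Then: 1. $L(X)=1$ if and only if $M(X)=1$ and $X$ is not a simplex. 2. $L(X)=2$ if and only if $M(X)=2$ and $\tilde H_1(X[W])\ne 0$ for some $W\subseteq V$. Moreover, if $L(X)=2$, then for every $W\subseteq V$ with $\tilde H_1(X[W])\neq 0$ there is $U\subseteq W$ such that $X[U]$ is a cycle (a one-dimensional complex whose edges form a cycle graph on $n\ge 3$ vertices) and the class of the sum of the edges of $X[U]$ generates $\tilde H_1(X[W])$. 3. For every $k\ge 3$: $L(X)=k$ if and only if $M(X)=k$ and $\tilde H_{k-1}(X[W])\ne 0$ for some $W\subseteq V$. Moreover, if $L(X)=k$, then for every $W\subseteq V$ with $\tilde H_{k-1}(X[W])\ne 0$ there is $U\subseteq W$ such that $X[U]$ is isomorphic to $\partial\Delta(k+1)$ and the class of the sum of the $(k-1)$-dimensional faces of $X[U]$ generates $\tilde H_{k-1}(X[W])$.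 Furthermore, if $L(X)=k$ with $k\ge 2$, then $\tilde\beta_{k-1}(X[W])\le 1$ for every $W\subseteq V$. -/

import Mathlib

open Finset

noncomputable section

namespace WeakShell

/-- A (finite abstract) simplicial complex on the vertex set `V`: a family of subsets of `V` closed
under taking subsets. The void complex `⊥` (no face at all) and `{∅}` are both allowed, and elements
of `V` need not be faces. Intersection of complexes is `⊓`, inclusion is `≤`. -/
abbrev Cx (V : Type*) := LowerSet (Finset V)

variable {V : Type*}

/-- The simplex `Δ(σ)`: all subsets of `σ`. -/
abbrev simplex (σ : Finset V) : Cx V := LowerSet.Iic σ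

/-- The boundary `∂Δ(S)` of the simplex on `S`: all proper subsets of `S`. -/
abbrev simplexBoundary (S : Finset V) : Cx V := LowerSet.Iio S

/-- `X` is a simplex on some (possibly empty) set of vertices. -/
def IsSimplex (X : Cx V) : Prop := ∃ σ : Finset V, X = simplex σ

/-- The induced subcomplex `X[W]`: the faces of `X` contained in `W`. -/
def induced (X : Cx V) (W : Finset V) : Cx V := X ⊓ simplex W

/-- A facet is a face that is maximal under inclusion. -/
def IsFacet (X : Cx V) (σ : Finset V) : Prop := Maximal (fun F => F ∈ X) σ

/-! ### Reduced simplicial homology over `ℤ/2` -/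

section Homology

variable [DecidableEq V]

/-- The `ℤ/2`-linear boundary operator, on formal sums of finite sets:
`F ↦ ∑ v ∈ F, F \ {v}`. It sends a single vertex to the empty face (the augmentation). -/
def boundary (V : Type*) [DecidableEq V] : (Finset V →₀ ZMod 2) →ₗ[ZMod 2] (Finset V →₀ ZMod 2) :=
  Finsupp.linearCombination (ZMod 2) fun F => ∑ v ∈ F, Finsupp.single (F.erase v) 1

/-- `C_n(X)`: formal sums of the `n`-dimensional faces (those with `n + 1` elements) of `X`. -/
def chains (X : Cx V) (n : ℕ) : Submodule (ZMod 2) (Finset V →₀ ZMod 2) :=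
  Finsupp.supported (ZMod 2) (ZMod 2) {F | F ∈ X ∧ #F = n + 1}

/-- The `n`-cycles of `X`. -/
def cycles (X : Cx V) (n : ℕ) : Submodule (ZMod 2) (Finset V →₀ ZMod 2) :=
  chains X n ⊓ LinearMap.ker (boundary V)

/-- The `n`-boundaries of `X`. -/
def boundaries (X : Cx V) (n : ℕ) : Submodule (ZMod 2) (Finset V →₀ ZMod 2) :=
  (chains X (n + 1)).map (boundary V)

theorem boundary_boundary (c : Finset V →₀ ZMod 2) : boundary V (boundary V c) = 0 := by
  induction c using Finsupp.induction_linear with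
  | zero => simp
  | add f g hf hg => simp [hf, hg]
  | single F a =>
    have key : ∑ v ∈ F, ∑ w ∈ F.erase v,
        (Finsupp.single ((F.erase v).erase w) (1 : ZMod 2)) = 0 := by
      rw [Finset.sum_sigma']
      refine Finset.sum_involution (fun p _ => ⟨p.2, p.1⟩) ?_ ?_ ?_ ?_
      · rintro ⟨v, w⟩ _
        rw [Finset.erase_right_comm, ← Finsupp.single_add]
        have : (1 : ZMod 2) + 1 = 0 := by decide
        simp [this]
      · rintro ⟨v, w⟩ h _ heq
        simp only [Finset.mem_sigma, Finset.mem_erase] at h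
        simp only [Sigma.mk.injEq, heq_eq_eq] at heq
        exact h.2.1 heq.1
      · rintro ⟨v, w⟩ h
        simp only [Finset.mem_sigma, Finset.mem_erase] at h ⊢
        exact ⟨h.2.2, Ne.symm h.2.1, h.1⟩
      · rintro ⟨v, w⟩ _
        rfl
    simp [boundary, Finsupp.linearCombination_single, key]

theorem boundaries_le_cycles (X : Cx V) (n : ℕ) : boundaries X n ≤ cycles X n := by
  rintro _ ⟨c, hc, rfl⟩
  refine ⟨?_, boundary_boundary c⟩
  have h1 : boundary V c = c.sum fun F a => a • ∑ v ∈ F, Finsupp.single (F.erase v) (1 : ZMod 2) :=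
    Finsupp.linearCombination_apply _ _
  rw [h1]
  refine Submodule.sum_mem _ fun F hF => Submodule.smul_mem _ _ (Submodule.sum_mem _ fun v hv => ?_)
  obtain ⟨hFX, hFc⟩ := hc (Finset.mem_coe.2 hF)
  refine Finsupp.single_mem_supported _ _ ⟨X.lower (Finset.erase_subset v F) hFX, ?_⟩
  rw [Finset.card_erase_of_mem hv, hFc]
  rfl

/-- The `n`-boundaries of `X`, as a subspace of the space of `n`-cycles. -/
def boundariesInCycles (X : Cx V) (n : ℕ) : Submodule (ZMod 2) (cycles X n) :=
  (boundaries X n).submoduleOf (cycles X n)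

/-- The reduced homology `H̃_n(X)` with coefficients in `ℤ/2`: cycles modulo boundaries. -/
abbrev Homology (X : Cx V) (n : ℕ) : Type _ := cycles X n ⧸ boundariesInCycles X n

/-- The homology class of a cycle. -/
abbrev homologyClass (X : Cx V) (n : ℕ) (z : cycles X n) : Homology X n :=
  Submodule.Quotient.mk z

/-- The reduced Betti number `β̃_n(X)`. -/
def betti (X : Cx V) (n : ℕ) : ℕ := Module.finrank (ZMod 2) (Homology X n)

/-- `X` is `d`-Leray: `H̃_i(X[W]) = 0` for all `i ≥ d` and all `W ⊆ V`. -/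
def IsLeray (X : Cx V) (d : ℕ) : Prop :=
  ∀ i, d ≤ i → ∀ W : Finset V, Subsingleton (Homology (induced X W) i)

/-- The Leray number `L(X)`, the least `d` such that `X` is `d`-Leray. -/
def lerayNumber (X : Cx V) : ℕ := sInf {d | IsLeray X d}

open Classical in
/-- The sum of all `n`-dimensional faces of `Y`. -/
def faceSum [Fintype V] (Y : Cx V) (n : ℕ) : Finset V →₀ ZMod 2 :=
  ∑ F : Finset V with F ∈ Y ∧ #F = n + 1, Finsupp.single F 1

/-- The subcomplex `Y` corresponds to a generator of `H̃_n(X)`: the sum of the `n`-faces of `Y` is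
an `n`-cycle of `X` whose class generates `H̃_n(X)`. -/
def GivesGenerator [Fintype V] (Y X : Cx V) (n : ℕ) : Prop :=
  ∃ hz : faceSum Y n ∈ cycles X n,
    Submodule.span (ZMod 2) {homologyClass X n ⟨faceSum Y n, hz⟩} = ⊤

/-- `Y` is a cycle, as a one-dimensional complex: for some `n ≥ 3` there are distinct vertices
`v_0, …, v_{n-1}` such that the faces of `Y` are the subsets of the edges `{v_i, v_{i+1}}`
(indices modulo `n`). -/
def IsCycle (Y : Cx V) : Prop :=
  ∃ (n : ℕ) (v : Fin (n + 3) → V), Function.Injective v ∧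
    ∀ F : Finset V, F ∈ Y ↔ ∃ i, F ⊆ {v i, v (i + 1)}

end Homology

/-! ### Orders of the facets

A linear order `σ_1 ≺ ⋯ ≺ σ_m` of facets is recorded as the list `[σ_m, …, σ_1]`, the last attached
facet first, so that dropping the head of the list passes from `X_j` to `X_{j-1}`. -/

/-- The union of the simplices `Δ(σ)` for `σ` in the list. -/
def unionOf (l : List (Finset V)) : Cx V where
  carrier := {F | ∃ σ ∈ l, F ⊆ σ}
  lower' := fun _ _ hGF ⟨σ, hσ, hF⟩ => ⟨σ, hσ, subset_trans hGF hF⟩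

/-- `l` lists every facet of `X` exactly once. -/
def IsFacetOrder (X : Cx V) (l : List (Finset V)) : Prop :=
  l.Nodup ∧ ∀ σ, σ ∈ l ↔ IsFacet X σ

open Classical in
/-- `M_≺`: it is `1` for a single facet, and attaching a further facet `σ_j` adds `0` if
`X_{j-1} ∩ Δ(σ_j)` is a simplex and `1` otherwise. -/
def orderM : List (Finset V) → ℕ
  | [] => 0
  | [_] => 1
  | σ :: τ :: l =>
    if IsSimplex (unionOf (τ :: l) ⊓ simplex σ) then orderM (τ :: l) else orderM (τ :: l) + 1

/-- `M(X)`, the minimum of `M_≺(X)` over all linear orders `≺` of the facets of `X`. -/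
def facetM (X : Cx V) : ℕ := sInf {k | ∃ l, IsFacetOrder X l ∧ orderM l = k}

/-- The condition on the order in a weak shelling: for every `j ≥ 2` there is a vertex `u_j` such
that `X_{j-1}[σ_j \ {u_j}]` is a simplex. -/
def WeakShellingOrder [DecidableEq V] : List (Finset V) → Prop
  | [] => True
  | [_] => True
  | σ :: τ :: l => (∃ u : V, IsSimplex (induced (unionOf (τ :: l)) (σ.erase u))) ∧
      WeakShellingOrder (τ :: l)

/-- `l` is a weak shelling of `X`. -/
def IsWeakShelling [DecidableEq V] (X : Cx V) (l : List (Finset V)) : Prop :=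
  IsFacetOrder X l ∧ WeakShellingOrder l

end WeakShell

end

open WeakShell

namespace WeakShell

variable {V : Type*}

/-! ### Complexes -/

/-! Let `σ` be the facet attached last and `Z` the union of the earlier ones. For every `W` the
complex on `W` is `Z[W] ∪ Δ(σ ∩ W)`, and the two pieces meet in `Z[σ ∩ W]`, again an induced
subcomplex of `Z`. Simplices are acyclic, so Mayer–Vietoris drives inductions along the order. If `Z
∩ Δ(σ)` is a simplex, neither `M_≺` nor the homology on `W` in positive degrees changes. Otherwise
`M_≺` rises by one, and the connecting map sends the classes in the new top degree `M_≺ - 1`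
injectively to classes of `Z[σ ∩ W]` one degree lower.

Hence homology vanishes from degree `M_≺` on (`isAcyclicAt_of_orderM_le`), and in degree `M_≺ - 1 ≥
1` any two nonzero classes agree (`add_mem_boundaries_of_orderM`). The weak shelling enters at the
bottom: since `Z[σ \ {u}]` is a simplex, the class of a 0-cycle in `Z[σ ∩ W]` is determined by its
coefficient at `u`.

By uniqueness, a generator is any non-bounding cycle of the required shape. In degree 1 it is a
shortest path in `Z[W]` from `u` to another vertex of `σ`, closed up by an edge inside `σ`
(`exists_inducedCycle`). In higher degrees (`exists_missing_face`), `Z[σ ∩ W]` has by induction a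
generator `∂U` with `U` a missing face; at the lowest level an induced cycle inside `σ` must be a
triangle. By uniqueness `∂U` represents the connecting class, so it bounds in `Z[W]`. The key lemma
`exists_apex` then fills it by a cone with a single apex `w`, and `U ∪ {w}` is the new missing face.
-/

theorem mem_unionOf_cons {σ : Finset V} {l : List (Finset V)} {F : Finset V} :
    F ∈ unionOf (σ :: l) ↔ F ∈ unionOf l ∨ F ⊆ σ := by
  change (∃ τ ∈ σ :: l, F ⊆ τ) ↔ (∃ τ ∈ l, F ⊆ τ) ∨ F ⊆ σ
  rw [List.exists_mem_cons_iff]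
  exact or_comm

theorem unionOf_cons (σ : Finset V) (l : List (Finset V)) :
    unionOf (σ :: l) = unionOf l ⊔ simplex σ := by
  ext F
  exact mem_unionOf_cons

/-- When an induced subcomplex is a simplex, its vertices alone decide which sets are faces. Applied
both to `Z[σ \ {u}]` and to `Z ⊓ simplex σ`, which is `Z[σ]` by definition. -/
theorem mem_of_isSimplex_induced {Z : Cx V} {S F : Finset V} (h : IsSimplex (induced Z S))
    (hF : F ⊆ S) (hv : ∀ v ∈ F, {v} ∈ Z) : F ∈ Z := by
  obtain ⟨τ, hτ⟩ := h
  have hτZ : τ ∈ induced Z S := by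
    rw [hτ]
    exact subset_rfl (a := τ)
  refine Z.lower (fun v hvF => ?_) hτZ.1
  have h1 : {v} ∈ induced Z S := ⟨hv v hvF, Finset.singleton_subset_iff.2 (hF hvF)⟩
  rw [hτ] at h1
  exact Finset.singleton_subset_iff.1 h1

theorem mem_of_mem_support {X : Cx V} {n : ℕ} {c : Finset V →₀ ZMod 2} (hc : c ∈ chains X n)
    {F : Finset V} (hF : F ∈ c.support) : F ∈ X ∧ #F = n + 1 :=
  hc (Finset.mem_coe.2 hF)

theorem single_mem_chains {X : Cx V} {n : ℕ} {F : Finset V} (hF : F ∈ X) (hn : #F = n + 1) :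
    Finsupp.single F 1 ∈ chains X n :=
  Finsupp.single_mem_supported _ _ ⟨hF, hn⟩

theorem chains_mono {A B : Cx V} (h : A ≤ B) (n : ℕ) : chains A n ≤ chains B n :=
  Finsupp.supported_mono fun _ hF => ⟨h hF.1, hF.2⟩

theorem chains_sup (A B : Cx V) (n : ℕ) : chains (A ⊔ B) n = chains A n ⊔ chains B n := by
  rw [chains, chains, chains, ← Finsupp.supported_union]
  congr 1
  ext F
  exact or_and_right

theorem mem_chains_inf {A B : Cx V} {n : ℕ} {c : Finset V →₀ ZMod 2} (hA : c ∈ chains A n)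
    (hB : c ∈ chains B n) : c ∈ chains (A ⊓ B) n :=
  fun _ hF => ⟨⟨(hA hF).1, (hB hF).1⟩, (hA hF).2⟩

theorem eq_of_add_eq_zero {a b : Finset V →₀ ZMod 2} (h : a + b = 0) : a = b := by
  rwa [← ZModModule.sub_eq_add, sub_eq_zero] at h

theorem one_le_orderM_cons (σ : Finset V) (l : List (Finset V)) : 1 ≤ orderM (σ :: l) := by
  induction l generalizing σ with
  | nil => simp [orderM]
  | cons ρ l ih =>
    rw [orderM]
    have := ih ρ
    split_ifs <;> omega

variable [DecidableEq V]

theorem induced_sup_simplex (Z : Cx V) (σ W : Finset V) :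
    induced (Z ⊔ simplex σ) W = induced Z W ⊔ simplex (σ ∩ W) := by
  ext F
  change (F ∈ Z ∨ F ⊆ σ) ∧ F ⊆ W ↔ (F ∈ Z ∧ F ⊆ W) ∨ F ⊆ σ ∩ W
  rw [Finset.subset_inter_iff]
  tauto

theorem induced_inf_simplex (Z : Cx V) (σ W : Finset V) :
    induced Z W ⊓ simplex (σ ∩ W) = induced Z (σ ∩ W) := by
  ext F
  change (F ∈ Z ∧ F ⊆ W) ∧ F ⊆ σ ∩ W ↔ F ∈ Z ∧ F ⊆ σ ∩ W
  rw [Finset.subset_inter_iff]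
  tauto

theorem induced_unionOf_cons (σ : Finset V) (l : List (Finset V)) (W : Finset V) :
    induced (unionOf (σ :: l)) W = induced (unionOf l) W ⊔ simplex (σ ∩ W) := by
  rw [unionOf_cons, induced_sup_simplex]

theorem induced_simplex (τ W : Finset V) : induced (simplex τ) W = simplex (τ ∩ W) := by
  ext F
  exact Finset.subset_inter_iff.symm

theorem IsSimplex.induced {Y : Cx V} (h : IsSimplex Y) (W : Finset V) :
    IsSimplex (induced Y W) := by
  obtain ⟨τ, rfl⟩ := h
  exact ⟨_, induced_simplex τ W⟩

theorem induced_induced {Z : Cx V} (S T : Finset V) : induced (induced Z S) T = induced Z (S ∩ T) := by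
  ext F
  change (F ∈ Z ∧ F ⊆ S) ∧ F ⊆ T ↔ F ∈ Z ∧ F ⊆ S ∩ T
  rw [Finset.subset_inter_iff]
  tauto

theorem IsSimplex.induced_of_subset {Z : Cx V} {S T : Finset V} (h : IsSimplex (WeakShell.induced Z S))
    (hT : T ⊆ S) : IsSimplex (WeakShell.induced Z T) := by
  have := h.induced T
  rwa [induced_induced, Finset.inter_eq_right.2 hT] at this

/-! ### Chains -/

theorem boundary_single (F : Finset V) :
    boundary V (Finsupp.single F 1) = ∑ v ∈ F, Finsupp.single (F.erase v) 1 := by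
  simp [boundary, Finsupp.linearCombination_single]

theorem exists_of_boundary_ne_zero {c : Finset V →₀ ZMod 2} {G : Finset V}
    (h : boundary V c G ≠ 0) : ∃ H ∈ c.support, ∃ y ∈ H, H.erase y = G := by
  by_contra! hc
  apply h
  have h1 : boundary V c = c.sum fun F a => a • ∑ v ∈ F, Finsupp.single (F.erase v) (1 : ZMod 2) :=
    Finsupp.linearCombination_apply _ _
  rw [h1, Finsupp.sum, Finsupp.finsetSum_apply]
  refine Finset.sum_eq_zero fun H hH => ?_
  rw [Finsupp.smul_apply, Finsupp.finsetSum_apply, Finset.sum_eq_zero, smul_zero]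
  intro y hy
  exact Finsupp.single_eq_of_ne (hc H hH y hy).symm

theorem boundary_single_apply_erase {F : Finset V} {v : V} (hv : v ∈ F) :
    boundary V (Finsupp.single F 1) (F.erase v) = 1 := by
  rw [boundary_single, Finsupp.finsetSum_apply, Finset.sum_eq_single_of_mem v hv]
  · simp
  · intro w hw hwv
    refine Finsupp.single_eq_of_ne fun h => hwv ?_
    exact (Finset.erase_injOn F hv hw h).symm

theorem boundaries_mono {A B : Cx V} (h : A ≤ B) (n : ℕ) : boundaries A n ≤ boundaries B n :=
  Submodule.map_mono (chains_mono h _)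

theorem boundary_mem_boundaries {X : Cx V} {n : ℕ} {c : Finset V →₀ ZMod 2}
    (hc : c ∈ chains X (n + 1)) : boundary V c ∈ boundaries X n :=
  Submodule.mem_map_of_mem hc

theorem boundary_mem_chains {X : Cx V} {n : ℕ} {c : Finset V →₀ ZMod 2}
    (hc : c ∈ chains X (n + 1)) : boundary V c ∈ chains X n :=
  (boundaries_le_cycles X n (boundary_mem_boundaries hc)).1

theorem mem_cycles {X : Cx V} {n : ℕ} {c : Finset V →₀ ZMod 2} :
    c ∈ cycles X n ↔ c ∈ chains X n ∧ boundary V c = 0 := Iff.rfl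

/-- The reduced homology of `X` vanishes in degree `n`. -/
def IsAcyclicAt (X : Cx V) (n : ℕ) : Prop := cycles X n ≤ boundaries X n

theorem subsingleton_homology_iff {X : Cx V} {n : ℕ} :
    Subsingleton (Homology X n) ↔ IsAcyclicAt X n := by
  rw [Submodule.Quotient.subsingleton_iff]
  exact Submodule.submoduleOf_eq_top

theorem nontrivial_homology_iff {X : Cx V} {n : ℕ} :
    Nontrivial (Homology X n) ↔ ∃ z ∈ cycles X n, z ∉ boundaries X n := by
  rw [← not_subsingleton_iff_nontrivial, subsingleton_homology_iff, IsAcyclicAt,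
    SetLike.not_le_iff_exists]

/-! ### Mayer–Vietoris -/

section MayerVietoris

variable {A B : Cx V} {n : ℕ} {a b z : Finset V →₀ ZMod 2}

/-- The connecting map at chain level: `boundary V a` represents the image of the class of `z`. -/
theorem exists_split_of_mem_cycles (hz : z ∈ cycles (A ⊔ B) (n + 1)) :
    ∃ a ∈ chains A (n + 1), ∃ b ∈ chains B (n + 1), a + b = z ∧ boundary V a = boundary V b ∧
      boundary V a ∈ cycles (A ⊓ B) n := by
  obtain ⟨hz1, hz2⟩ := mem_cycles.1 hz
  rw [chains_sup] at hz1
  obtain ⟨a, ha, b, hb, rfl⟩ := Submodule.mem_sup.1 hz1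
  rw [map_add] at hz2
  have hab := eq_of_add_eq_zero hz2
  refine ⟨a, ha, b, hb, rfl, hab, ?_, boundary_boundary a⟩
  exact mem_chains_inf (boundary_mem_chains ha) (hab ▸ boundary_mem_chains hb)

/-- The connecting map is well defined: it kills boundaries. Its contrapositive certifies that the
generators constructed below do not bound. -/
theorem boundary_mem_boundaries_inf (ha : a ∈ chains A (n + 1)) (hb : b ∈ chains B (n + 1))
    (h : a + b ∈ boundaries (A ⊔ B) (n + 1)) : boundary V a ∈ boundaries (A ⊓ B) n := by
  obtain ⟨c, hc, hcab⟩ := h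
  rw [SetLike.mem_coe, chains_sup] at hc
  obtain ⟨p, hp, q, hq, rfl⟩ := Submodule.mem_sup.1 hc
  have hpq : a - boundary V p = boundary V q - b := by
    rw [map_add] at hcab
    rw [sub_eq_sub_iff_add_eq_add, ← hcab, add_comm]
  refine ⟨a - boundary V p, ?_, by rw [map_sub, boundary_boundary, sub_zero]⟩
  refine mem_chains_inf (sub_mem ha (boundary_mem_chains hp)) ?_
  rw [hpq]
  exact sub_mem (boundary_mem_chains hq) hb

/-- Exactness at the union: a class killed by the connecting map comes from `A`, since `B`
contributes nothing. The cycle is `a` corrected by a filling of its boundary inside `A ⊓ B`. -/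
theorem exists_cycle_homologous (ha : a ∈ chains A (n + 1)) (hb : b ∈ chains B (n + 1))
    (hab : boundary V a = boundary V b) (h : boundary V a ∈ boundaries (A ⊓ B) n)
    (hB : IsAcyclicAt B (n + 1)) :
    ∃ z ∈ cycles A (n + 1), a + b + z ∈ boundaries (A ⊔ B) (n + 1) := by
  obtain ⟨e, he, hea⟩ := h
  refine ⟨a - e, ⟨sub_mem ha (chains_mono inf_le_left _ he), ?_⟩, ?_⟩
  · rw [SetLike.mem_coe, LinearMap.mem_ker, map_sub, hea, sub_self]
  · have h1 : a + b + (a - e) = b - e := by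
      have := ZModModule.add_self a
      calc a + b + (a - e) = (a + a) + (b - e) := by abel
        _ = b - e := by rw [this, zero_add]
    rw [h1]
    refine boundaries_mono le_sup_right _ (hB ⟨sub_mem hb (chains_mono inf_le_right _ he), ?_⟩)
    rw [SetLike.mem_coe, LinearMap.mem_ker, map_sub, hea, hab, sub_self]

/-- Injectivity of the connecting map when both pieces are acyclic in this degree. -/
theorem add_mem_boundaries_sup (ha : a ∈ chains A (n + 1)) (hb : b ∈ chains B (n + 1))
    (hab : boundary V a = boundary V b) (h : boundary V a ∈ boundaries (A ⊓ B) n)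
    (hA : IsAcyclicAt A (n + 1)) (hB : IsAcyclicAt B (n + 1)) :
    a + b ∈ boundaries (A ⊔ B) (n + 1) := by
  obtain ⟨z, hz, hz'⟩ := exists_cycle_homologous ha hb hab h hB
  exact (add_mem_cancel_right (boundaries_mono le_sup_left _ (hA hz))).1 hz'

/-- Injectivity of `H̃_n(A) → H̃_n(A ∪ B)`: if `z` is the boundary of `p + q`, then `boundary V q`
is a cycle of the intersection, so it already bounds there. -/
theorem mem_boundaries_of_mem_boundaries_sup (hAB : IsAcyclicAt (A ⊓ B) n) (hz : z ∈ cycles A n)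
    (h : z ∈ boundaries (A ⊔ B) n) : z ∈ boundaries A n := by
  obtain ⟨c, hc, rfl⟩ := h
  rw [SetLike.mem_coe, chains_sup] at hc
  obtain ⟨p, hp, q, hq, rfl⟩ := Submodule.mem_sup.1 hc
  rw [map_add] at hz ⊢
  have hq' : boundary V q ∈ chains A n := by
    have := sub_mem hz.1 (boundary_mem_chains hp)
    rwa [add_sub_cancel_left] at this
  refine add_mem (boundary_mem_boundaries hp) (boundaries_mono inf_le_left _ (hAB ⟨?_, ?_⟩))
  · exact mem_chains_inf hq' (boundary_mem_chains hq)
  · exact boundary_boundary q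

end MayerVietoris

/-! ### Acyclicity of simplices and the bound on the Leray number -/

/-- The cone operator with apex `v`. -/
noncomputable def coneMap (v : V) : (Finset V →₀ ZMod 2) →ₗ[ZMod 2] (Finset V →₀ ZMod 2) :=
  Finsupp.linearCombination (ZMod 2) fun F => if v ∈ F then 0 else Finsupp.single (insert v F) 1

theorem coneMap_single (v : V) (F : Finset V) :
    coneMap v (Finsupp.single F 1) = if v ∈ F then 0 else Finsupp.single (insert v F) 1 := by
  simp [coneMap, Finsupp.linearCombination_single]

/-- Coning is a contracting homotopy. No correction term is needed in degree 0, because `boundary`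
includes the augmentation to the empty face. -/
theorem boundary_coneMap_add (v : V) (c : Finset V →₀ ZMod 2) :
    boundary V (coneMap v c) + coneMap v (boundary V c) = c := by
  have key : boundary V ∘ₗ coneMap v + coneMap v ∘ₗ boundary V = LinearMap.id := by
    refine Finsupp.lhom_ext' fun F => LinearMap.ext_ring ?_
    simp only [LinearMap.add_apply, LinearMap.comp_apply, Finsupp.lsingle_apply, LinearMap.id_apply]
    rw [coneMap_single, boundary_single, map_sum]
    simp_rw [coneMap_single]
    by_cases hv : v ∈ F
    · rw [if_pos hv, map_zero, zero_add, Finset.sum_eq_single_of_mem v hv]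
      · rw [if_neg (Finset.notMem_erase v F), Finset.insert_erase hv]
      · intro w _ hwv
        rw [if_pos (Finset.mem_erase.2 ⟨hwv.symm, hv⟩)]
    · rw [if_neg hv, boundary_single, Finset.sum_insert hv, Finset.erase_insert hv, add_assoc,
        ← Finset.sum_add_distrib, Finset.sum_eq_zero, add_zero]
      intro w hw
      have hwv : v ≠ w := fun h => hv (h ▸ hw)
      rw [if_neg (fun h => hv (Finset.mem_of_mem_erase h)), Finset.erase_insert_of_ne hwv]
      exact ZModModule.add_self _
  exact LinearMap.congr_fun key c

theorem isAcyclicAt_simplex (σ : Finset V) (n : ℕ) : IsAcyclicAt (simplex σ) n := by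
  intro z hz
  obtain ⟨hz1, hz2⟩ := mem_cycles.1 hz
  rcases σ.eq_empty_or_nonempty with rfl | ⟨v, hv⟩
  · have : z = 0 := by
      rw [← Finsupp.support_eq_empty, Finset.eq_empty_iff_forall_notMem]
      intro F hF
      obtain ⟨h1, h2⟩ := mem_of_mem_support hz1 hF
      have : F = ∅ := Finset.subset_empty.1 h1
      rw [this, Finset.card_empty] at h2
      omega
    rw [this]
    exact zero_mem _
  · have h := boundary_coneMap_add v z
    rw [hz2, map_zero, add_zero] at h
    rw [← h]
    refine boundary_mem_boundaries ?_
    rw [coneMap, Finsupp.linearCombination_apply]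
    refine Submodule.sum_mem _ fun F hF => Submodule.smul_mem _ _ ?_
    obtain ⟨h1, h2⟩ := mem_of_mem_support hz1 hF
    split_ifs with hvF
    · exact zero_mem _
    · refine single_mem_chains (Finset.insert_subset hv h1) ?_
      rw [Finset.card_insert_of_notMem hvF, h2]

theorem IsSimplex.isAcyclicAt {Y : Cx V} (h : IsSimplex Y) (n : ℕ) : IsAcyclicAt Y n := by
  obtain ⟨σ, rfl⟩ := h
  exact isAcyclicAt_simplex σ n

/-- Mayer–Vietoris: either the intersection is a simplex, or `orderM` drops by one and the induction
hypothesis applies to `Z[σ ∩ W]` one degree lower. This needs the statement for all `W` at once. -/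
theorem isAcyclicAt_of_orderM_le : ∀ (l : List (Finset V)) (n : ℕ), orderM l ≤ n →
    ∀ W : Finset V, IsAcyclicAt (induced (unionOf l) W) n
  | [], n, _, W => by
    intro z hz
    have : z = 0 := by
      rw [← Finsupp.support_eq_empty, Finset.eq_empty_iff_forall_notMem]
      intro F hF
      obtain ⟨⟨_, h, _⟩, _⟩ := (mem_of_mem_support hz.1 hF).1
      simp at h
    rw [this]
    exact zero_mem _
  | [σ], n, _, W => by
    refine IsSimplex.isAcyclicAt (IsSimplex.induced ⟨σ, ?_⟩ W) n
    ext F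
    change (∃ τ ∈ [σ], F ⊆ τ) ↔ F ⊆ σ
    simp
  | σ :: τ :: l, n, hn, W => by
    have ih := isAcyclicAt_of_orderM_le (τ :: l)
    have hpos := one_le_orderM_cons τ l
    rw [induced_unionOf_cons]
    rw [orderM] at hn
    obtain ⟨m, rfl⟩ : ∃ m, n = m + 1 := ⟨n - 1, by split_ifs at hn <;> omega⟩
    have hY : IsAcyclicAt (induced (unionOf (τ :: l)) (σ ∩ W)) m := by
      split_ifs at hn with hs
      · exact (IsSimplex.induced_of_subset hs Finset.inter_subset_left).isAcyclicAt m
      · exact ih m (by omega) _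
    intro z hz
    obtain ⟨a, ha, b, hb, rfl, hab, hc⟩ := exists_split_of_mem_cycles hz
    rw [induced_inf_simplex] at hc
    refine add_mem_boundaries_sup ha hb hab ?_ (ih _ ?_ W) (isAcyclicAt_simplex _ _)
    · rw [induced_inf_simplex]
      exact hY hc
    · split_ifs at hn <;> omega

end WeakShell

namespace WeakShell

variable {V : Type*} [DecidableEq V]

/-! ### Uniqueness of the homology class in the top degree -/

/-- A 0-cycle that avoids `u` lives in an induced subcomplex of the simplex `Z[σ \ {u}]`, so it
bounds there. -/
theorem mem_boundaries_of_apply_eq_zero {Z : Cx V} {σ S : Finset V} {u : V}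
    (hs : IsSimplex (induced Z (σ.erase u))) (hS : S ⊆ σ) {y : Finset V →₀ ZMod 2}
    (hy : y ∈ cycles (induced Z S) 0) (hyu : y {u} = 0) : y ∈ boundaries (induced Z S) 0 := by
  have hle : induced Z (S.erase u) ≤ induced Z S :=
    fun F hF => ⟨hF.1, hF.2.trans (Finset.erase_subset u S)⟩
  refine boundaries_mono hle 0 ?_
  refine (hs.induced_of_subset (Finset.erase_subset_erase u hS)).isAcyclicAt 0 ⟨fun F hF => ?_, hy.2⟩
  obtain ⟨⟨h1, h2⟩, h3⟩ := hy.1 hF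
  refine ⟨⟨h1, fun v hv => Finset.mem_erase.2 ⟨?_, h2 hv⟩⟩, h3⟩
  rintro rfl
  obtain ⟨w, rfl⟩ := Finset.card_eq_one.1 h3
  rw [Finset.mem_singleton.1 hv] at hyu
  exact Finsupp.mem_support_iff.1 hF hyu

/-- Both cycles have coefficient 1 at `u`, so their sum avoids `u`. -/
theorem add_mem_boundaries_zero {Z : Cx V} {σ S : Finset V} {u : V}
    (hs : IsSimplex (induced Z (σ.erase u))) (hS : S ⊆ σ) {y₁ y₂ : Finset V →₀ ZMod 2}
    (h₁ : y₁ ∈ cycles (induced Z S) 0) (h₁' : y₁ ∉ boundaries (induced Z S) 0)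
    (h₂ : y₂ ∈ cycles (induced Z S) 0) (h₂' : y₂ ∉ boundaries (induced Z S) 0) :
    y₁ + y₂ ∈ boundaries (induced Z S) 0 := by
  have key : ∀ a b : ZMod 2, a ≠ 0 → b ≠ 0 → a + b = 0 := by decide
  refine mem_boundaries_of_apply_eq_zero hs hS (add_mem h₁ h₂) (key _ _ (fun h => h₁' ?_)
    (fun h => h₂' ?_))
  · exact mem_boundaries_of_apply_eq_zero hs hS h₁ h
  · exact mem_boundaries_of_apply_eq_zero hs hS h₂ h

theorem boundary_notMem_of_notMem {A B : Cx V} {n : ℕ} {a b : Finset V →₀ ZMod 2}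
    (ha : a ∈ chains A (n + 1)) (hb : b ∈ chains B (n + 1))
    (hab : boundary V a = boundary V b) (hA : IsAcyclicAt A (n + 1)) (hB : IsAcyclicAt B (n + 1))
    (h : a + b ∉ boundaries (A ⊔ B) (n + 1)) : boundary V a ∉ boundaries (A ⊓ B) n :=
  fun h' => h (add_mem_boundaries_sup ha hb hab h' hA hB)

/-- At a simplex step both cycles are pushed into `Z[W]`; at any other step the connecting map is
injective and uniqueness is pulled back from `Z[σ ∩ W]`. -/
theorem add_mem_boundaries_of_orderM : ∀ (l : List (Finset V)), WeakShellingOrder l →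
    ∀ k, orderM l = k + 2 → ∀ (W : Finset V) (z₁ z₂ : Finset V →₀ ZMod 2),
    z₁ ∈ cycles (induced (unionOf l) W) (k + 1) → z₁ ∉ boundaries (induced (unionOf l) W) (k + 1) →
    z₂ ∈ cycles (induced (unionOf l) W) (k + 1) → z₂ ∉ boundaries (induced (unionOf l) W) (k + 1) →
    z₁ + z₂ ∈ boundaries (induced (unionOf l) W) (k + 1)
  | [], _, k, hk, _, _, _, _, _, _, _ => by simp [orderM] at hk
  | [_], _, k, hk, _, _, _, _, _, _, _ => by simp [orderM] at hk
  | σ :: τ :: l, hl, k, hk, W, z₁, z₂, h₁, h₁', h₂, h₂' => by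
    have ih := add_mem_boundaries_of_orderM (τ :: l) hl.2
    obtain ⟨u, hu⟩ := hl.1
    rw [induced_unionOf_cons] at h₁ h₁' h₂ h₂' ⊢
    obtain ⟨a₁, ha₁, b₁, hb₁, rfl, hab₁, hc₁⟩ := exists_split_of_mem_cycles h₁
    obtain ⟨a₂, ha₂, b₂, hb₂, rfl, hab₂, hc₂⟩ := exists_split_of_mem_cycles h₂
    by_cases hs : IsSimplex (unionOf (τ :: l) ⊓ simplex σ)
    · rw [orderM, if_pos hs] at hk
      have hY : IsAcyclicAt (induced (unionOf (τ :: l)) W ⊓ simplex (σ ∩ W)) k := by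
        rw [induced_inf_simplex]
        exact (IsSimplex.induced_of_subset hs Finset.inter_subset_left).isAcyclicAt k
      obtain ⟨y₁, hy₁, hzy₁⟩ := exists_cycle_homologous ha₁ hb₁ hab₁ (hY hc₁)
        (isAcyclicAt_simplex _ _)
      obtain ⟨y₂, hy₂, hzy₂⟩ := exists_cycle_homologous ha₂ hb₂ hab₂ (hY hc₂)
        (isAcyclicAt_simplex _ _)
      have hn₁ : y₁ ∉ boundaries (induced (unionOf (τ :: l)) W) (k + 1) := fun h =>
        h₁' ((add_mem_cancel_right (boundaries_mono le_sup_left _ h)).1 hzy₁)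
      have hn₂ : y₂ ∉ boundaries (induced (unionOf (τ :: l)) W) (k + 1) := fun h =>
        h₂' ((add_mem_cancel_right (boundaries_mono le_sup_left _ h)).1 hzy₂)
      have hy := ih k hk W y₁ y₂ hy₁ hn₁ hy₂ hn₂
      refine (add_mem_cancel_right (boundaries_mono le_sup_left _ hy)).1 ?_
      rw [add_add_add_comm]
      exact add_mem hzy₁ hzy₂
    · rw [orderM, if_neg hs] at hk
      have hA := isAcyclicAt_of_orderM_le (τ :: l) (k + 1) (by omega) W
      have hn₁ := boundary_notMem_of_notMem ha₁ hb₁ hab₁ hA (isAcyclicAt_simplex _ _) h₁'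
      have hn₂ := boundary_notMem_of_notMem ha₂ hb₂ hab₂ hA (isAcyclicAt_simplex _ _) h₂'
      rw [add_add_add_comm]
      refine add_mem_boundaries_sup (add_mem ha₁ ha₂) (add_mem hb₁ hb₂) ?_ ?_ hA
        (isAcyclicAt_simplex _ _)
      · rw [map_add, map_add, hab₁, hab₂]
      · rw [induced_inf_simplex] at hn₁ hn₂ hc₁ hc₂ ⊢
        rw [map_add]
        -- In degree 0 uniqueness comes from the weak shelling vertex instead of the induction.
        cases k with
        | zero => exact add_mem_boundaries_zero hu Finset.inter_subset_left hc₁ hn₁ hc₂ hn₂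
        | succ k => exact ih k (by omega) _ _ _ hc₁ hn₁ hc₂ hn₂

/-! ### Filling the boundary of a missing face by a cone -/

/-- For reasons of size, only `U` itself could occur in a filling inside `Z[U]`. -/
theorem boundary_single_notMem_boundaries {Z : Cx V} {U : Finset V} (hU : U ∉ Z) {n : ℕ}
    (hn : #U = n + 2) : boundary V (Finsupp.single U 1) ∉ boundaries (induced Z U) n := by
  rintro ⟨c, hc, hcU⟩
  obtain ⟨v, hv⟩ : U.Nonempty := Finset.card_pos.1 (by omega)
  have h1 := boundary_single_apply_erase hv
  rw [← hcU] at h1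
  obtain ⟨H, hH, -⟩ := exists_of_boundary_ne_zero (h1.trans_ne one_ne_zero)
  obtain ⟨⟨h2, h3⟩, h4⟩ := mem_of_mem_support hc hH
  exact hU (Finset.eq_of_subset_of_card_le h3 (by omega) ▸ h2)

theorem boundary_single_mem_cycles {Z : Cx V} {U : Finset V} {n : ℕ} (hn : #U = n + 2)
    (hb : ∀ x ∈ U, U.erase x ∈ Z) : boundary V (Finsupp.single U 1) ∈ cycles Z n := by
  refine ⟨?_, boundary_boundary _⟩
  rw [boundary_single]
  refine Submodule.sum_mem _ fun x hx => single_mem_chains (hb x hx) ?_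
  rw [Finset.card_erase_of_mem hx]
  omega

/-- The two cones over `∂F` form a suspension, which is a cycle of `Z` because `F` cancels. In any
filling on these vertices, a face containing `v ∪ (F \ x)` must add `w`: the only alternative `x`
would put the missing face `F` in `Z`. -/
theorem insert_insert_erase_mem_of_isAcyclicAt {Z : Cx V} {F : Finset V} {v w : V} {n : ℕ}
    (hF : F ∉ Z) (hn : #F = n + 1) (hv : v ∉ F) (hw : w ∉ F) (hvw : v ≠ w)
    (hvF : ∀ x ∈ F, insert v (F.erase x) ∈ Z) (hwF : ∀ x ∈ F, insert w (F.erase x) ∈ Z)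
    (hZ : IsAcyclicAt (induced Z (insert v (insert w F))) n) :
    ∀ x ∈ F, insert v (insert w (F.erase x)) ∈ Z := by
  intro x hx
  set s := boundary V (Finsupp.single (insert v F) 1) + boundary V (Finsupp.single (insert w F) 1)
    with hs
  have hs' : s = ∑ y ∈ F, (Finsupp.single (insert v (F.erase y)) 1 +
      Finsupp.single (insert w (F.erase y)) 1) := by
    rw [hs, boundary_single, boundary_single, Finset.sum_insert hv, Finset.sum_insert hw,
      Finset.erase_insert hv, Finset.erase_insert hw, add_add_add_comm, ZModModule.add_self,
      zero_add, ← Finset.sum_add_distrib]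
    refine Finset.sum_congr rfl fun y hy => ?_
    rw [Finset.erase_insert_of_ne (by rintro rfl; exact hv hy),
      Finset.erase_insert_of_ne (by rintro rfl; exact hw hy)]
  have hcard : ∀ t ∉ F, ∀ y ∈ F, #(insert t (F.erase y)) = n + 1 := by
    intro t ht y hy
    rw [Finset.card_insert_of_notMem fun h => ht (Finset.mem_of_mem_erase h),
      Finset.card_erase_of_mem hy]
    omega
  have hcyc : s ∈ cycles (induced Z (insert v (insert w F))) n := by
    refine ⟨?_, ?_⟩
    · rw [hs']
      refine Submodule.sum_mem _ fun y hy => add_mem ?_ ?_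
      · refine single_mem_chains ⟨hvF y hy, ?_⟩ (hcard v hv y hy)
        exact Finset.insert_subset_insert v
          ((Finset.erase_subset y F).trans (Finset.subset_insert w F))
      · refine single_mem_chains ⟨hwF y hy, ?_⟩ (hcard w hw y hy)
        exact (Finset.insert_subset_insert w (Finset.erase_subset y F)).trans
          (Finset.subset_insert v _)
    · rw [SetLike.mem_coe, LinearMap.mem_ker, hs, map_add, boundary_boundary, boundary_boundary,
        add_zero]
  have hxv : v ≠ x := by rintro rfl; exact hv hx
  have hsG : s (insert v (F.erase x)) ≠ 0 := by
    have h1 : boundary V (Finsupp.single (insert v F) 1) (insert v (F.erase x)) = 1 := by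
      rw [← Finset.erase_insert_of_ne hxv]
      exact boundary_single_apply_erase (Finset.mem_insert_of_mem hx)
    have h2 : boundary V (Finsupp.single (insert w F) 1) (insert v (F.erase x)) = 0 := by
      by_contra h
      obtain ⟨H, hH, y, hy, hHy⟩ := exists_of_boundary_ne_zero h
      rw [Finset.mem_singleton.1 (Finsupp.support_single_subset hH)] at hHy
      have h3 : v ∈ (insert w F).erase y := hHy ▸ Finset.mem_insert_self _ _
      rcases Finset.mem_insert.1 (Finset.mem_of_mem_erase h3) with h4 | h4
      · exact hvw h4
      · exact hv h4
    rw [hs, Finsupp.add_apply, h1, h2, add_zero]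
    exact one_ne_zero
  obtain ⟨c, hc, hcs⟩ := hZ hcyc
  rw [← hcs] at hsG
  obtain ⟨H, hH, y, hy, hHy⟩ := exists_of_boundary_ne_zero hsG
  obtain ⟨⟨hHZ, hHs⟩, -⟩ := mem_of_mem_support hc hH
  have hH' : H = insert y (insert v (F.erase x)) := by rw [← hHy, Finset.insert_erase hy]
  have hyG : y ∉ insert v (F.erase x) := hHy ▸ Finset.notMem_erase y H
  rw [hH'] at hHZ
  rcases Finset.mem_insert.1 (hHs hy) with rfl | h
  · exact absurd (Finset.mem_insert_self _ _) hyG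
  rcases Finset.mem_insert.1 h with rfl | h
  · rwa [Finset.insert_comm] at hHZ
  · have hyx : y = x := by
      by_contra hne
      exact hyG (Finset.mem_insert_of_mem (Finset.mem_erase.2 ⟨hne, h⟩))
    subst hyx
    rw [Finset.insert_comm, Finset.insert_erase hx] at hHZ
    exact absurd (Z.lower (Finset.subset_insert v F) hHZ) hF

/-- Since `Z[σ \ {u}]` is a simplex, a missing edge has `u` as an end. Its boundary bounds, so `u`
has a neighbour in `S`, and that neighbour is joined to (or equals) the other end. -/
theorem exists_apex_of_card_eq_two {Z : Cx V} {σ S F : Finset V} {u : V}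
    (hs : IsSimplex (induced Z (σ.erase u))) (hS : S ⊆ σ) (hFS : F ⊆ S) (hF : #F = 2)
    (hFZ : F ∉ Z) (h : boundary V (Finsupp.single F 1) ∈ boundaries (induced Z S) 0) :
    ∃ w ∈ S, ∀ y ∈ F, insert w (F.erase y) ∈ Z := by
  obtain ⟨c, hc, hcF⟩ := h
  have hmem : ∀ y ∈ F, ∃ w ∈ S, w ∉ F.erase y ∧ insert w (F.erase y) ∈ Z := by
    intro y hy
    have h1 := boundary_single_apply_erase hy
    rw [← hcF] at h1
    obtain ⟨H, hH, w, hw, hHw⟩ := exists_of_boundary_ne_zero (h1.trans_ne one_ne_zero)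
    obtain ⟨⟨h2, h3⟩, -⟩ := mem_of_mem_support hc hH
    refine ⟨w, h3 hw, hHw ▸ Finset.notMem_erase w H, ?_⟩
    rwa [← hHw, Finset.insert_erase hw]
  obtain ⟨a, b, hab, rfl⟩ := Finset.card_eq_two.1 hF
  have hea : ({a, b} : Finset V).erase a = {b} := Finset.erase_insert (by simpa using hab)
  have heb : ({a, b} : Finset V).erase b = {a} := by
    rw [Finset.pair_comm]
    exact Finset.erase_insert (by simpa using hab.symm)
  obtain ⟨w₁, hw₁, hw₁', hw₁Z⟩ := hmem a (by simp)
  obtain ⟨w₂, hw₂, hw₂', hw₂Z⟩ := hmem b (by simp)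
  rw [hea] at hw₁' hw₁Z
  rw [heb] at hw₂' hw₂Z
  rw [Finset.mem_singleton] at hw₁' hw₂'
  have haZ : {a} ∈ Z := Z.lower (Finset.subset_insert _ _) hw₂Z
  have hbZ : {b} ∈ Z := Z.lower (Finset.subset_insert _ _) hw₁Z
  have hw₁v : {w₁} ∈ Z := Z.lower (by simp) hw₁Z
  have hw₂v : {w₂} ∈ Z := Z.lower (by simp) hw₂Z
  have haσ : a ∈ σ := hS (hFS (by simp))
  have hbσ : b ∈ σ := hS (hFS (by simp))
  have key : ∀ p q, p ∈ σ → q ∈ σ → {p} ∈ Z → {q} ∈ Z → p ≠ u → q ≠ u → {p, q} ∈ Z := by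
    intro p q hp hq hpZ hqZ hpu hqu
    refine mem_of_isSimplex_induced hs ?_ ?_
    · simp [Finset.insert_subset_iff, hp, hq, hpu, hqu]
    · simp [hpZ, hqZ]
  by_cases hau : a = u
  · refine ⟨w₂, hw₂, ?_⟩
    simp only [Finset.mem_insert, Finset.mem_singleton, forall_eq_or_imp, forall_eq, hea, heb]
    exact ⟨key w₂ b (hS hw₂) hbσ hw₂v hbZ (hau ▸ hw₂') (hau ▸ hab.symm), hw₂Z⟩
  · by_cases hbu : b = u
    · refine ⟨w₁, hw₁, ?_⟩
      simp only [Finset.mem_insert, Finset.mem_singleton, forall_eq_or_imp, forall_eq, hea, heb]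
      exact ⟨hw₁Z, key w₁ a (hS hw₁) haσ hw₁v haZ (hbu ▸ hw₁') hau⟩
    · exact absurd (key a b haσ hbσ haZ hbZ hau hbu) hFZ

theorem subset_of_erase_subset {U σ : Finset V} {x y : V} (hxy : x ≠ y)
    (hx : U.erase x ⊆ σ) (hy : U.erase y ⊆ σ) : U ⊆ σ := by
  intro v hv
  by_cases hvx : v = x
  · exact hy (Finset.mem_erase.2 ⟨hvx ▸ hxy, hv⟩)
  · exact hx (Finset.mem_erase.2 ⟨hvx, hv⟩)

/-- At a non-simplex step exactly one facet `F = U \ x` of `U` is missing from `Z`, and `F ⊆ σ`. By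
induction `∂F` has an apex `w` in `σ ∩ W`. Acyclicity of `Z` fills the suspension of `∂F` with poles
`x` and `w`, which makes `w` an apex for `∂U` too. -/
theorem exists_apex : ∀ (l : List (Finset V)), WeakShellingOrder l → ∀ e, orderM l = e + 2 →
    ∀ U W : Finset V, U ⊆ W → #U = e + 3 → U ∉ unionOf l → (∀ x ∈ U, U.erase x ∈ unionOf l) →
    boundary V (Finsupp.single U 1) ∈ boundaries (induced (unionOf l) W) (e + 1) →
    ∃ w ∈ W, ∀ x ∈ U, insert w (U.erase x) ∈ unionOf l
  | [], _, _, hM, _, _, _, _, _, _, _ => by simp [orderM] at hM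
  | [_], _, _, hM, _, _, _, _, _, _, _ => by simp [orderM] at hM
  | σ :: τ :: l, hl, e, hM, U, W, hUW, hU, hUn, hUb, hz => by
    have ih := exists_apex (τ :: l) hl.2
    have hacyc := isAcyclicAt_of_orderM_le (τ :: l)
    obtain ⟨u, hu⟩ := hl.1
    rw [orderM] at hM
    generalize hZ : unionOf (τ :: l) = Z at *
    rw [mem_unionOf_cons, hZ, not_or] at hUn
    have hUb' : ∀ x ∈ U, U.erase x ∈ Z ∨ U.erase x ⊆ σ := fun x hx => by
      rw [← hZ]
      exact mem_unionOf_cons.1 (hUb x hx)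
    rw [induced_unionOf_cons, hZ] at hz
    by_cases hs : IsSimplex (Z ⊓ simplex σ)
    · rw [if_pos hs] at hM
      have hUbZ : ∀ x ∈ U, U.erase x ∈ Z := by
        intro x hx
        refine (hUb' x hx).elim id fun hxσ => ?_
        refine mem_of_isSimplex_induced hs hxσ fun y hy => ?_
        -- The facet of `U` omitting this third element contains `y`; it lies in `Z`, since two
        -- facets inside `σ` would force `U ⊆ σ`.
        obtain ⟨z, hz⟩ : ((U.erase x).erase y).Nonempty := by
          rw [← Finset.card_pos, Finset.card_erase_of_mem hy, Finset.card_erase_of_mem hx]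
          omega
        simp only [Finset.mem_erase] at hz hy
        rcases hUb' z hz.2.2 with h | h
        · refine Z.lower ?_ h
          exact Finset.singleton_subset_iff.2 (Finset.mem_erase.2 ⟨hz.1.symm, hy.2⟩)
        · exact absurd (subset_of_erase_subset hz.2.1.symm hxσ h) hUn.2
      have hcyc : boundary V (Finsupp.single U 1) ∈ cycles (induced Z W) (e + 1) :=
        boundary_single_mem_cycles (by omega)
          fun x hx => ⟨hUbZ x hx, (Finset.erase_subset x U).trans hUW⟩
      have hzZ := mem_boundaries_of_mem_boundaries_sup (by
        rw [induced_inf_simplex]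
        exact (IsSimplex.induced_of_subset hs Finset.inter_subset_left).isAcyclicAt _) hcyc hz
      obtain ⟨w, hw, hwU⟩ := ih e hM U W hUW hU hUn.1 hUbZ hzZ
      exact ⟨w, hw, fun x hx => mem_unionOf_cons.2 (Or.inl (hZ ▸ hwU x hx))⟩
    · rw [if_neg hs] at hM
      obtain ⟨x, hx, hxZ⟩ : ∃ x ∈ U, U.erase x ∉ Z := by
        by_contra! hcon
        refine boundary_single_notMem_boundaries hUn.1 (n := e + 1) (by omega) ?_
        exact hacyc (e + 1) (by omega) U (boundary_single_mem_cycles (by omega)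
          fun x hx => ⟨hcon x hx, Finset.erase_subset x U⟩)
      have hxσ := (hUb' x hx).resolve_left hxZ
      have hxnσ : x ∉ σ := fun h => hUn.2 (by
        rw [← Finset.insert_erase hx]
        exact Finset.insert_subset h hxσ)
      have hyZ : ∀ y ∈ U.erase x, U.erase y ∈ Z := by
        intro y hy
        obtain ⟨hyx, hyU⟩ := Finset.mem_erase.1 hy
        exact (hUb' y hyU).resolve_right fun h => hUn.2 (subset_of_erase_subset hyx h hxσ)
      have hFc : #(U.erase x) = e + 2 := by rw [Finset.card_erase_of_mem hx]; omega
      have hFS : U.erase x ⊆ σ ∩ W :=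
        Finset.subset_inter hxσ ((Finset.erase_subset x U).trans hUW)
      -- Splitting `∂U` into `F` (in `Δ(σ ∩ W)`) and the other facets (in `Z[W]`), the connecting
      -- map yields `∂F`.
      have hFbd : boundary V (Finsupp.single (U.erase x) 1) ∈ boundaries (induced Z (σ ∩ W)) e := by
        rw [← induced_inf_simplex, inf_comm]
        refine boundary_mem_boundaries_inf (single_mem_chains hFS hFc)
          (b := ∑ y ∈ U.erase x, Finsupp.single (U.erase y) 1) ?_ ?_
        · refine Submodule.sum_mem _ fun y hy => single_mem_chains
            ⟨hyZ y hy, (Finset.erase_subset y U).trans hUW⟩ ?_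
          rw [Finset.card_erase_of_mem (Finset.mem_of_mem_erase hy)]
          omega
        · rw [Finset.add_sum_erase U (fun y => Finsupp.single (U.erase y) 1) hx, ← boundary_single, sup_comm]
          exact hz
      obtain ⟨w, hw, hwF⟩ : ∃ w ∈ σ ∩ W, ∀ y ∈ U.erase x, insert w ((U.erase x).erase y) ∈ Z := by
        cases e with
        | zero => exact exists_apex_of_card_eq_two hu Finset.inter_subset_left hFS hFc hxZ hFbd
        | succ e =>
          refine ih e (by omega) (U.erase x) (σ ∩ W) hFS (by omega) hxZ (fun y hy => ?_) hFbd
          refine Z.lower ?_ (hyZ y hy)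
          rw [Finset.erase_right_comm]
          exact Finset.erase_subset _ _
      rw [Finset.mem_inter] at hw
      have hwx : x ≠ w := fun h => hxnσ (h ▸ hw.1)
      have hwF' : w ∉ U.erase x := fun h => hxZ (by
        have := hwF w h
        rwa [Finset.insert_erase h] at this)
      have hins : ∀ y ∈ U.erase x, insert x ((U.erase x).erase y) = U.erase y := by
        intro y hy
        rw [Finset.erase_right_comm, Finset.insert_erase]
        exact Finset.mem_erase.2 ⟨(Finset.mem_erase.1 hy).1.symm, hx⟩
      have hsusp := insert_insert_erase_mem_of_isAcyclicAt hxZ (n := e + 1) hFc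
        (Finset.notMem_erase x U) hwF' hwx (fun y hy => (hins y hy).symm ▸ hyZ y hy) hwF
        (hacyc (e + 1) (by omega) _)
      refine ⟨w, hw.2, fun y hy => ?_⟩
      rw [mem_unionOf_cons, hZ]
      by_cases hyx : y = x
      · subst hyx
        exact Or.inr (Finset.insert_subset hw.1 hxσ)
      · have hyF := Finset.mem_erase.2 ⟨hyx, hy⟩
        have := hsusp y hyF
        rw [Finset.insert_comm, hins y hyF] at this
        exact Or.inl this

end WeakShell

namespace WeakShell

variable {V : Type*}

/-! ### Induced cycles -/

/-- A walk of minimal length from `u` to `T`: repeated vertices, chords or an earlier visit to `T`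
would shorten it. -/
theorem exists_induced_path {G : SimpleGraph V} {u : V} {T : Set V}
    (h : ∃ t ∈ T, G.Reachable u t) : ∃ (r : ℕ) (p : ℕ → V), p 0 = u ∧ p r ∈ T ∧
      (∀ i < r, G.Adj (p i) (p (i + 1))) ∧ (∀ i ≤ r, p i ∈ T → i = r) ∧
      (∀ i ≤ r, ∀ j ≤ r, p i = p j → i = j) ∧
      (∀ i ≤ r, ∀ j ≤ r, G.Adj (p i) (p j) → j ≤ i + 1) := by
  classical
  have hex : ∃ n, ∃ t ∈ T, ∃ w : G.Walk u t, w.length = n := by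
    obtain ⟨t, ht, ⟨w⟩⟩ := h
    exact ⟨_, t, ht, w, rfl⟩
  obtain ⟨t, ht, w, hw⟩ := Nat.find_spec hex
  have hmin : ∀ t ∈ T, ∀ q : G.Walk u t, w.length ≤ q.length := fun t ht q =>
    hw ▸ Nat.find_min' hex ⟨t, ht, q, rfl⟩
  have hdist : ∀ i ≤ w.length, ∀ q : G.Walk u (w.getVert i), i ≤ q.length := by
    intro i hi q
    have := hmin t ht (q.append (w.drop i))
    rw [SimpleGraph.Walk.length_append, SimpleGraph.Walk.drop_length] at this
    omega
  have htake : ∀ i ≤ w.length, (w.take i).length = i := fun i hi => by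
    rw [SimpleGraph.Walk.take_length]
    omega
  have hle : ∀ i ≤ w.length, ∀ j ≤ w.length, w.getVert i = w.getVert j → j ≤ i := by
    intro i hi j hj hij
    have := hdist j hj ((w.take i).copy rfl hij)
    rwa [SimpleGraph.Walk.length_copy, htake i hi] at this
  refine ⟨w.length, w.getVert, w.getVert_zero, by rwa [w.getVert_length],
    fun i hi => w.adj_getVert_succ hi, fun i hi hiT => ?_, fun i hi j hj hij => ?_,
    fun i hi j hj hij => ?_⟩
  · have := hmin _ hiT (w.take i)
    rw [htake i hi] at this
    omega
  · exact le_antisymm (hle j hj i hi hij.symm) (hle i hi j hj hij)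
  · have := hdist j hj ((w.take i).concat hij)
    rwa [SimpleGraph.Walk.length_concat, htake i hi] at this

variable [DecidableEq V]

/-- The graph whose edges are the one-dimensional faces of `Z`. -/
def edgeGraph (Z : Cx V) : SimpleGraph V where
  Adj x y := x ≠ y ∧ {x, y} ∈ Z
  symm := ⟨fun x y h => ⟨h.1.symm, Finset.pair_comm x y ▸ h.2⟩⟩
  loopless := ⟨fun _ h => h.1 rfl⟩

theorem boundary_single_pair {x y : V} (h : x ≠ y) :
    boundary V (Finsupp.single {x, y} 1) = Finsupp.single {x} 1 + Finsupp.single {y} 1 := by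
  have hx : ({x, y} : Finset V).erase x = {y} := Finset.erase_insert (by simpa using h)
  have hy : ({x, y} : Finset V).erase y = {x} := by
    rw [Finset.pair_comm]
    exact Finset.erase_insert (by simpa using h.symm)
  rw [boundary_single, Finset.sum_pair h, hx, hy, add_comm]

/-- The functional `φ` counts, mod 2, the vertices in the component of `u`; it vanishes on
boundaries of edges. -/
theorem reachable_of_boundary_mem {Z : Cx V} {u t : V} (hut : u ≠ t)
    (h : boundary V (Finsupp.single {u, t} 1) ∈ boundaries Z 0) : (edgeGraph Z).Reachable u t := by
  classical
  let φ : (Finset V →₀ ZMod 2) →ₗ[ZMod 2] ZMod 2 := Finsupp.linearCombination (ZMod 2)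
    fun F => if ∃ x, F = {x} ∧ (edgeGraph Z).Reachable u x then 1 else 0
  have hφ : ∀ x, φ (Finsupp.single {x} 1) = if (edgeGraph Z).Reachable u x then 1 else 0 := by
    intro x
    simp [φ, Finsupp.linearCombination_single]
  have hker : boundaries Z 0 ≤ LinearMap.ker φ := by
    rw [boundaries, Submodule.map_le_iff_le_comap, chains, Finsupp.supported_eq_span_single,
      Submodule.span_le]
    rintro _ ⟨F, ⟨hFZ, hF⟩, rfl⟩
    obtain ⟨x, y, hxy, rfl⟩ := Finset.card_eq_two.1 hF
    have hadj : (edgeGraph Z).Reachable x y := SimpleGraph.Adj.reachable ⟨hxy, hFZ⟩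
    have hiff : (edgeGraph Z).Reachable u x ↔ (edgeGraph Z).Reachable u y :=
      ⟨fun h => h.trans hadj, fun h => h.trans hadj.symm⟩
    rw [SetLike.mem_coe, Submodule.mem_comap, LinearMap.mem_ker]
    dsimp only
    rw [boundary_single_pair hxy, map_add, hφ, hφ, hiff]
    split_ifs <;> decide
  have h0 := hker h
  rw [LinearMap.mem_ker, boundary_single_pair hut, map_add, hφ, hφ,
    if_pos (SimpleGraph.Reachable.refl u)] at h0
  by_contra hn
  rw [if_neg hn, add_zero] at h0
  exact one_ne_zero h0

/-- The vertices `v 0, …, v (n + 2)` are distinct and span an induced cycle of `X`. -/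
def IsInducedCycle (X : Cx V) {n : ℕ} (v : Fin (n + 3) → V) : Prop :=
  Function.Injective v ∧ ∀ F ⊆ Finset.univ.image v, F ∈ X ↔ ∃ i, F ⊆ {v i, v (i + 1)}

/-- The sum of the edges of the closed polygon `v`. -/
noncomputable def edgeSum {n : ℕ} (v : Fin (n + 3) → V) : Finset V →₀ ZMod 2 :=
  ∑ i, Finsupp.single {v i, v (i + 1)} 1

theorem ne_add_one {n : ℕ} (i : Fin (n + 3)) : i ≠ i + 1 := by
  intro h
  have : (1 : Fin (n + 3)) = 0 := by simpa using h.symm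
  simp at this

theorem edgeSum_mem_cycles {n : ℕ} {v : Fin (n + 3) → V} (hv : Function.Injective v) {Z : Cx V}
    (hZ : ∀ i, {v i, v (i + 1)} ∈ Z) : edgeSum v ∈ cycles Z 1 := by
  have hne : ∀ i, v i ≠ v (i + 1) := fun i h => ne_add_one i (hv h)
  refine ⟨Submodule.sum_mem _ fun i _ => single_mem_chains (hZ i) (Finset.card_pair (hne i)), ?_⟩
  rw [SetLike.mem_coe, LinearMap.mem_ker, edgeSum, map_sum]
  simp_rw [boundary_single_pair (hne _)]
  rw [Finset.sum_add_distrib]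
  have := Equiv.sum_comp (Equiv.addRight (1 : Fin (n + 3)))
    fun i => (Finsupp.single {v i} 1 : Finset V →₀ ZMod 2)
  simp only [Equiv.coe_addRight] at this
  rw [this]
  exact ZModModule.add_self _

theorem IsInducedCycle.edge_mem {X : Cx V} {n : ℕ} {v : Fin (n + 3) → V} (h : IsInducedCycle X v)
    (i : Fin (n + 3)) : {v i, v (i + 1)} ∈ X :=
  (h.2 _ (by simp [Finset.insert_subset_iff])).2 ⟨i, subset_rfl⟩

theorem IsInducedCycle.vertex_mem {X : Cx V} {n : ℕ} {v : Fin (n + 3) → V}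
    (h : IsInducedCycle X v) {x : V} (hx : x ∈ Finset.univ.image v) : {x} ∈ X := by
  obtain ⟨i, -, rfl⟩ := Finset.mem_image.1 hx
  exact X.lower (by simp) (h.edge_mem i)

/-- Minimality keeps the interior of the path outside `σ`, so attaching `σ` adds only the closing
edge among the path's vertices. The boundary of that edge does not bound in `Z[σ ∩ W]`, hence
neither does the cycle in the union. -/
theorem exists_inducedCycle_attach {Z : Cx V} {σ W : Finset V} {u : V}
    (hs : IsSimplex (induced Z (σ.erase u))) {y : Finset V →₀ ZMod 2}
    (hy : y ∈ cycles (induced Z (σ ∩ W)) 0) (hyn : y ∉ boundaries (induced Z (σ ∩ W)) 0)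
    (hyW : y ∈ boundaries (induced Z W) 0) :
    ∃ (n : ℕ) (v : Fin (n + 3) → V), IsInducedCycle (Z ⊔ simplex σ) v ∧ (∀ i, v i ∈ W) ∧
      edgeSum v ∉ boundaries (induced Z W ⊔ simplex (σ ∩ W)) 1 := by
  have hle : induced Z (σ ∩ W) ≤ induced Z W :=
    fun F hF => ⟨hF.1, hF.2.trans Finset.inter_subset_right⟩
  have hZ2 : ∀ a : ZMod 2, a ≠ 0 → a = 1 := by decide
  have hyu : y {u} = 1 := hZ2 _ fun h =>
    hyn (mem_boundaries_of_apply_eq_zero hs Finset.inter_subset_left hy h)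
  have huY : {u} ∈ induced Z (σ ∩ W) :=
    (mem_of_mem_support hy.1 (Finsupp.mem_support_iff.2 (hyu.trans_ne one_ne_zero))).1
  have huσW := Finset.singleton_subset_iff.1 huY.2
  let T : Set V := {t | t ≠ u ∧ t ∈ σ ∩ W ∧ {t} ∈ Z}
  obtain ⟨t₀, ht₀⟩ : T.Nonempty := by
    by_contra hT
    have hsupp : y.support ⊆ {{u}} := by
      intro F hF
      obtain ⟨⟨h1, h2⟩, h3⟩ := mem_of_mem_support hy.1 hF
      obtain ⟨t, rfl⟩ := Finset.card_eq_one.1 h3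
      by_cases htu : t = u
      · simp [htu]
      · exact absurd ⟨t, htu, Finset.singleton_subset_iff.1 h2, h1⟩ hT
    have hy1 : y = Finsupp.single {u} 1 := by
      rw [← hyu]
      exact Finsupp.support_subset_singleton.1 hsupp
    have hy2 := (mem_cycles.1 hy).2
    rw [hy1, boundary_single, Finset.sum_singleton, Finsupp.single_eq_zero] at hy2
    exact one_ne_zero hy2
  have hpair : ∀ t ∈ T, boundary V (Finsupp.single {u, t} 1) ∉ boundaries (induced Z (σ ∩ W)) 0 ∧
      boundary V (Finsupp.single {u, t} 1) ∈ boundaries (induced Z W) 0 := by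
    rintro t ⟨htu, htS, htZ⟩
    have hcyc : boundary V (Finsupp.single {u, t} 1) ∈ cycles (induced Z (σ ∩ W)) 0 := by
      refine ⟨?_, boundary_boundary _⟩
      rw [boundary_single_pair htu.symm]
      exact add_mem (single_mem_chains huY rfl)
        (single_mem_chains ⟨htZ, Finset.singleton_subset_iff.2 htS⟩ rfl)
    have hadd : y + boundary V (Finsupp.single {u, t} 1) ∈ boundaries (induced Z (σ ∩ W)) 0 := by
      refine mem_boundaries_of_apply_eq_zero hs Finset.inter_subset_left (add_mem hy hcyc) ?_
      have h1 : ({u} : Finset V) ≠ {t} := fun h => htu (Finset.singleton_injective h).symm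
      rw [boundary_single_pair htu.symm, Finsupp.add_apply, Finsupp.add_apply,
        Finsupp.single_eq_same, Finsupp.single_eq_of_ne h1, hyu]
      decide
    exact ⟨fun h => hyn ((add_mem_cancel_right h).1 hadd),
      (add_mem_cancel_left hyW).1 (boundaries_mono hle 0 hadd)⟩
  obtain ⟨r, p, hp0, hpr, hadj, hpT, hinj, hchord⟩ := exists_induced_path (T := T)
    ⟨t₀, ht₀, reachable_of_boundary_mem ht₀.1.symm (hpair t₀ ht₀).2⟩
  have hurZ : {u, p r} ∉ Z := fun h => (hpair _ hpr).1 (boundary_mem_boundaries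
    (single_mem_chains ⟨h, Finset.insert_subset huσW (Finset.singleton_subset_iff.2 hpr.2.1)⟩
      (Finset.card_pair hpr.1.symm)))
  -- Length 0 is excluded because `u ∉ T`, length 1 because `u` and the endpoint are not adjacent in
  -- `Z`; so the closed path has at least three vertices.
  obtain ⟨n, rfl⟩ : ∃ n, r = n + 2 := by
    rcases r with _ | _ | n
    · exact absurd hp0 hpr.1
    · have := (hadj 0 (by omega)).2.1
      rw [hp0] at this
      exact absurd this hurZ
    · exact ⟨n, rfl⟩
  have hedge : ∀ i < n + 2, {p i, p (i + 1)} ∈ induced Z W := fun i hi => (hadj i hi).2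
  have hvert : ∀ i ≤ n + 2, {p i} ∈ Z ∧ p i ∈ W := by
    intro i hi
    rcases hi.lt_or_eq with hi | rfl
    · obtain ⟨h1, h2⟩ := hedge i hi
      exact ⟨Z.lower (by simp) h1, h2 (by simp)⟩
    · exact ⟨hpr.2.2, (Finset.mem_inter.1 hpr.2.1).2⟩
  have hσ : ∀ i ≤ n + 2, p i ∈ σ → i = 0 ∨ i = n + 2 := by
    intro i hi hiσ
    by_cases h0 : i = 0
    · exact Or.inl h0
    · refine Or.inr (hpT i hi ⟨fun h => h0 (hinj i hi 0 (by omega) (h.trans hp0.symm)), ?_,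
        (hvert i hi).1⟩)
      exact Finset.mem_inter.2 ⟨hiσ, (hvert i hi).2⟩
  have hlast : Fin.last (n + 2) + 1 = 0 := Fin.last_add_one _
  have hsucc : ∀ i : Fin (n + 2), i.castSucc + 1 = i.succ := fun i => by simp
  refine ⟨n, fun i => p i, ⟨fun i j hij => ?_, fun F hF => ⟨fun h => ?_, ?_⟩⟩, ?_, ?_⟩
  · exact Fin.ext (hinj i (by omega) j (by omega) hij)
  · rcases h with h | h
    · rcases F.eq_empty_or_nonempty with rfl | ⟨x, hx⟩
      · exact ⟨0, Finset.empty_subset _⟩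
      obtain ⟨i₀, -, hi₀⟩ := Finset.mem_image.1 (hF hx)
      -- With `m` the least index occurring in `F`, the absence of chords leaves only `m` and `m +
      -- 1`.
      obtain ⟨m, hm, hmin⟩ := Finset.exists_min_image (Finset.univ.filter fun i : Fin (n + 3) => p i ∈ F)
        (fun i => i) ⟨i₀, by simpa [hi₀] using hx⟩
      simp only [Finset.mem_filter, Finset.mem_univ, true_and] at hm hmin
      refine ⟨m, fun x hx => ?_⟩
      obtain ⟨j, -, rfl⟩ := Finset.mem_image.1 (hF hx)
      have hmj := hmin j hx
      rcases hmj.eq_or_lt with rfl | hlt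
      · simp
      · have hlt' : (m : ℕ) < j := hlt
        have hj : (j : ℕ) ≤ m + 1 := by
          refine hchord m (by omega) j (by omega) ⟨fun h => ?_, Z.lower ?_ h, ?_⟩
          · exact absurd (hinj m (by omega) j (by omega) h) hlt'.ne
          · simp [Finset.insert_subset_iff, hm, hx]
          · simp [Finset.insert_subset_iff, (hvert m (by omega)).2, (hvert j (by omega)).2]
        have hjm : j = m + 1 := by
          apply Fin.ext
          rw [Fin.val_add_one_of_lt (lt_of_lt_of_le hlt (Fin.le_last j))]
          omega
        simp [← hjm]
    · refine ⟨Fin.last (n + 2), fun x hx => ?_⟩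
      obtain ⟨j, -, rfl⟩ := Finset.mem_image.1 (hF hx)
      dsimp only
      rw [hlast]
      rcases hσ j (by omega) (h hx) with h | h <;> simp [h]
  · rintro ⟨i, hi⟩
    refine (Z ⊔ simplex σ).lower hi ?_
    dsimp only
    refine Fin.lastCases ?_ (fun i => ?_) i
    · right
      rw [hlast]
      intro x hx
      simp only [Fin.val_last, Fin.val_zero, Finset.mem_insert, Finset.mem_singleton] at hx
      rcases hx with rfl | rfl
      · exact (Finset.mem_inter.1 hpr.2.1).1
      · rw [hp0]
        exact (Finset.mem_inter.1 huσW).1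
    · left
      rw [hsucc]
      exact (hedge i (by omega)).1
  · exact fun i => (hvert i (by omega)).2
  · intro h
    rw [edgeSum, Fin.sum_univ_castSucc, add_comm, sup_comm] at h
    refine (hpair _ hpr).1 ?_
    rw [← induced_inf_simplex, inf_comm]
    have hl : ({p (Fin.last (n + 2) : Fin (n + 3)), p (Fin.last (n + 2) + 1 : Fin (n + 3))} :
        Finset V) = {u, p (n + 2)} := by
      rw [hlast, Finset.pair_comm]
      simp [hp0]
    rw [hl] at h
    refine boundary_mem_boundaries_inf (single_mem_chains ?_ ?_) ?_ h
    · change {u, p (n + 2)} ⊆ σ ∩ W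
      rw [Finset.insert_subset_iff, Finset.singleton_subset_iff]
      exact ⟨huσW, hpr.2.1⟩
    · exact Finset.card_pair hpr.1.symm
    · refine Submodule.sum_mem _ fun i _ => ?_
      rw [hsucc]
      exact single_mem_chains (hedge i (by omega)) (Finset.card_pair (hadj i (by omega)).1)

theorem exists_inducedCycle : ∀ (l : List (Finset V)), WeakShellingOrder l → orderM l = 2 →
    ∀ (W : Finset V) (z : Finset V →₀ ZMod 2), z ∈ cycles (induced (unionOf l) W) 1 →
    z ∉ boundaries (induced (unionOf l) W) 1 →
    ∃ (n : ℕ) (v : Fin (n + 3) → V), IsInducedCycle (unionOf l) v ∧ (∀ i, v i ∈ W) ∧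
      edgeSum v ∉ boundaries (induced (unionOf l) W) 1
  | [], _, hM, _, _, _, _ => by simp [orderM] at hM
  | [_], _, hM, _, _, _, _ => by simp [orderM] at hM
  | σ :: τ :: l, hl, hM, W, z, hz, hzn => by
    have ih := exists_inducedCycle (τ :: l) hl.2
    have hacyc := isAcyclicAt_of_orderM_le (τ :: l)
    obtain ⟨u, hu⟩ := hl.1
    rw [orderM] at hM
    rw [induced_unionOf_cons] at hz hzn ⊢
    rw [unionOf_cons]
    obtain ⟨a, ha, b, hb, rfl, hab, hc⟩ := exists_split_of_mem_cycles hz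
    generalize hZ : unionOf (τ :: l) = Z at *
    by_cases hs : IsSimplex (Z ⊓ simplex σ)
    · rw [if_pos hs] at hM
      have hY : ∀ k, IsAcyclicAt (induced Z W ⊓ simplex (σ ∩ W)) k := by
        rw [induced_inf_simplex]
        exact (IsSimplex.induced_of_subset hs Finset.inter_subset_left).isAcyclicAt
      obtain ⟨y, hy, hzy⟩ := exists_cycle_homologous ha hb hab (hY 0 hc) (isAcyclicAt_simplex _ _)
      obtain ⟨n, v, hv, hvW, hvn⟩ := ih hM W y hy fun h =>
        hzn ((add_mem_cancel_right (boundaries_mono le_sup_left _ h)).1 hzy)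
      refine ⟨n, v, ⟨hv.1, fun F hF => ?_⟩, hvW, fun h => hvn ?_⟩
      · rw [← hv.2 F hF]
        refine ⟨fun h => h.elim id fun hσ => ?_, Or.inl⟩
        exact mem_of_isSimplex_induced hs hσ fun x hx => hv.vertex_mem (hF hx)
      · refine mem_boundaries_of_mem_boundaries_sup (hY 1) (edgeSum_mem_cycles hv.1 fun i => ?_) h
        refine ⟨hv.edge_mem i, ?_⟩
        simp [Finset.insert_subset_iff, hvW]
    · rw [if_neg hs] at hM
      have hn := boundary_notMem_of_notMem ha hb hab (hacyc 1 (by omega) W)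
        (isAcyclicAt_simplex _ _) hzn
      rw [induced_inf_simplex] at hn hc
      exact exists_inducedCycle_attach hu hc hn (boundary_mem_boundaries ha)

/-! ### Induced boundaries of simplices -/

/-- Deleting `u` from an induced cycle inside `σ` leaves a face of `Z`, which has at most two
vertices; so the cycle is a triangle. -/
theorem exists_missing_triangle {Z : Cx V} {σ S : Finset V} {u : V}
    (hs : IsSimplex (induced Z (σ.erase u))) (hS : S ⊆ σ) {n : ℕ} {v : Fin (n + 3) → V}
    (hv : IsInducedCycle Z v) (hvS : ∀ i, v i ∈ S) (hvn : edgeSum v ∉ boundaries (induced Z S) 1) :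
    ∃ U ⊆ S, #U = 3 ∧ U ∉ Z ∧ (∀ x ∈ U, U.erase x ∈ Z) ∧
      boundary V (Finsupp.single U 1) ∉ boundaries (induced Z S) 1 := by
  have hsmall : ∀ F ⊆ Finset.univ.image v, F ∈ Z → #F ≤ 2 := by
    intro F hF hFZ
    obtain ⟨i, hi⟩ := (hv.2 F hF).1 hFZ
    exact (Finset.card_le_card hi).trans Finset.card_le_two
  have himS : Finset.univ.image v ⊆ S := by
    intro x hx
    obtain ⟨i, -, rfl⟩ := Finset.mem_image.1 hx
    exact hvS i
  have hcard : #(Finset.univ.image v) = n + 3 := by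
    rw [Finset.card_image_of_injective _ hv.1, Finset.card_univ, Fintype.card_fin]
  obtain rfl : n = 0 := by
    have h1 : (Finset.univ.image v).erase u ∈ Z := by
      refine mem_of_isSimplex_induced hs ?_ fun x hx =>
        hv.vertex_mem (Finset.mem_of_mem_erase hx)
      exact Finset.erase_subset_erase u (himS.trans hS)
    have h2 := hsmall _ (Finset.erase_subset _ _) h1
    have h3 := Finset.pred_card_le_card_erase (s := Finset.univ.image v) (a := u)
    omega
  have herase : ∀ i : Fin 3, (Finset.univ.image v).erase (v i) = {v (i + 1), v (i + 1 + 1)} := by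
    intro i
    have h1 : (Finset.univ : Finset (Fin 3)).erase i = {i + 1, i + 1 + 1} := by
      revert i
      decide
    rw [← Finset.image_erase hv.1, h1, Finset.image_insert, Finset.image_singleton]
  refine ⟨Finset.univ.image v, himS, hcard, fun h => ?_, fun x hx => ?_, ?_⟩
  · have := hsmall _ subset_rfl h
    omega
  · obtain ⟨i, -, rfl⟩ := Finset.mem_image.1 hx
    rw [herase]
    exact hv.edge_mem (i + 1)
  · rw [boundary_single, Finset.sum_image fun i _ j _ h => hv.1 h]
    simp_rw [herase]
    convert hvn using 2
    exact Equiv.sum_comp (Equiv.addRight (1 : Fin 3))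
      fun i => (Finsupp.single {v i, v (i + 1)} 1 : Finset V →₀ ZMod 2)

/-- The sphere `∂(U ∪ {w})` is the cone from `w` over `∂U`, lying in `Z`, capped by `U ⊆ σ`; the
connecting map sends it to `∂U`. -/
theorem exists_missing_face_attach {Z : Cx V} {σ W U : Finset V} {e : ℕ} (hU : U ⊆ σ ∩ W)
    (hUc : #U = e + 3) (hUZ : U ∉ Z)
    (hUn : boundary V (Finsupp.single U 1) ∉ boundaries (induced Z (σ ∩ W)) (e + 1)) {w : V}
    (hw : w ∈ W) (hwU : ∀ x ∈ U, insert w (U.erase x) ∈ Z) :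
    ∃ U' ⊆ W, #U' = e + 4 ∧ U' ∉ Z ⊔ simplex σ ∧ (∀ x ∈ U', U'.erase x ∈ Z ⊔ simplex σ) ∧
      boundary V (Finsupp.single U' 1) ∉
        boundaries (induced Z W ⊔ simplex (σ ∩ W)) (e + 2) := by
  have hwnU : w ∉ U := fun h => hUZ (by
    have := hwU w h
    rwa [Finset.insert_erase h] at this)
  have hne : ∀ x ∈ U, w ≠ x := fun x hx h => hwnU (h ▸ hx)
  have hsplit : boundary V (Finsupp.single (insert w U) 1) =
      Finsupp.single U 1 + ∑ x ∈ U, Finsupp.single (insert w (U.erase x)) 1 := by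
    rw [boundary_single, Finset.sum_insert hwnU, Finset.erase_insert hwnU]
    congr 1
    exact Finset.sum_congr rfl fun x hx => by rw [Finset.erase_insert_of_ne (hne x hx)]
  have hcard : ∀ x ∈ U, #(insert w (U.erase x)) = e + 3 := by
    intro x hx
    rw [Finset.card_insert_of_notMem fun h => hwnU (Finset.mem_of_mem_erase h),
      Finset.card_erase_of_mem hx]
    omega
  have hbdU : boundary V (Finsupp.single U 1) =
      boundary V (∑ x ∈ U, Finsupp.single (insert w (U.erase x)) 1) := by
    refine eq_of_add_eq_zero ?_
    rw [← map_add, ← hsplit, boundary_boundary]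
  have hUW := hU.trans Finset.inter_subset_right
  -- Otherwise the cone would fill `∂U` inside `Z[σ ∩ W]`.
  have hwσ : w ∉ σ := by
    intro hwσ
    rw [hbdU] at hUn
    refine hUn (boundary_mem_boundaries (Submodule.sum_mem _ fun x hx =>
      single_mem_chains ⟨hwU x hx, ?_⟩ (hcard x hx)))
    exact Finset.insert_subset (Finset.mem_inter.2 ⟨hwσ, hw⟩) ((Finset.erase_subset x U).trans hU)
  refine ⟨insert w U, Finset.insert_subset hw hUW, ?_, ?_, ?_, ?_⟩
  · rw [Finset.card_insert_of_notMem hwnU, hUc]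
  · rintro (h | h)
    · exact hUZ (Z.lower (Finset.subset_insert w U) h)
    · exact hwσ (h (Finset.mem_insert_self w U))
  · intro x hx
    rcases Finset.mem_insert.1 hx with rfl | hx
    · rw [Finset.erase_insert hwnU]
      exact Or.inr (hU.trans Finset.inter_subset_left)
    · rw [Finset.erase_insert_of_ne (hne x hx)]
      exact Or.inl (hwU x hx)
  · intro h
    rw [hsplit, sup_comm] at h
    refine hUn ?_
    rw [← induced_inf_simplex, inf_comm]
    refine boundary_mem_boundaries_inf (single_mem_chains hU hUc)
      (Submodule.sum_mem _ fun x hx => single_mem_chains ⟨hwU x hx, ?_⟩ (hcard x hx)) h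
    exact Finset.insert_subset hw ((Finset.erase_subset x U).trans hUW)

theorem exists_missing_face : ∀ (l : List (Finset V)), WeakShellingOrder l →
    ∀ e, orderM l = e + 3 → ∀ (W : Finset V) (z : Finset V →₀ ZMod 2),
    z ∈ cycles (induced (unionOf l) W) (e + 2) → z ∉ boundaries (induced (unionOf l) W) (e + 2) →
    ∃ U ⊆ W, #U = e + 4 ∧ U ∉ unionOf l ∧ (∀ x ∈ U, U.erase x ∈ unionOf l) ∧
      boundary V (Finsupp.single U 1) ∉ boundaries (induced (unionOf l) W) (e + 2)
  | [], _, _, hM, _, _, _, _ => by simp [orderM] at hM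
  | [_], _, _, hM, _, _, _, _ => by simp [orderM] at hM
  | σ :: τ :: l, hl, e, hM, W, z, hz, hzn => by
    have ih := exists_missing_face (τ :: l) hl.2
    have hcyc := exists_inducedCycle (τ :: l) hl.2
    have hacyc := isAcyclicAt_of_orderM_le (τ :: l)
    have happ := exists_apex (τ :: l) hl.2
    have hadd := add_mem_boundaries_of_orderM (τ :: l) hl.2
    obtain ⟨u, hu⟩ := hl.1
    rw [orderM] at hM
    rw [induced_unionOf_cons] at hz hzn ⊢
    rw [unionOf_cons]
    obtain ⟨a, ha, b, hb, rfl, hab, hc⟩ := exists_split_of_mem_cycles hz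
    generalize hZ : unionOf (τ :: l) = Z at *
    by_cases hs : IsSimplex (Z ⊓ simplex σ)
    · rw [if_pos hs] at hM
      have hY : ∀ k, IsAcyclicAt (induced Z W ⊓ simplex (σ ∩ W)) k := by
        rw [induced_inf_simplex]
        exact (IsSimplex.induced_of_subset hs Finset.inter_subset_left).isAcyclicAt
      obtain ⟨y, hy, hzy⟩ := exists_cycle_homologous ha hb hab (hY _ hc) (isAcyclicAt_simplex _ _)
      obtain ⟨U, hUW, hUc, hUZ, hUb, hUn⟩ := ih e hM W y hy fun h =>
        hzn ((add_mem_cancel_right (boundaries_mono le_sup_left _ h)).1 hzy)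
      refine ⟨U, hUW, hUc, fun h => ?_, fun x hx => Or.inl (hUb x hx), fun h => hUn ?_⟩
      · rcases h with h | h
        · exact hUZ h
        · refine hUZ (mem_of_isSimplex_induced hs h fun x hx => ?_)
          obtain ⟨y, hy⟩ : (U.erase x).Nonempty := by
            rw [← Finset.card_pos, Finset.card_erase_of_mem hx]
            omega
          rw [Finset.mem_erase] at hy
          exact Z.lower (Finset.singleton_subset_iff.2 (Finset.mem_erase.2 ⟨hy.1.symm, hx⟩))
            (hUb y hy.2)
      · refine mem_boundaries_of_mem_boundaries_sup (hY _) (boundary_single_mem_cycles hUc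
          fun x hx => ?_) h
        exact ⟨hUb x hx, (Finset.erase_subset x U).trans hUW⟩
    · rw [if_neg hs] at hM
      have hn := boundary_notMem_of_notMem ha hb hab (hacyc (e + 2) (by omega) W)
        (isAcyclicAt_simplex _ _) hzn
      rw [induced_inf_simplex] at hn hc
      obtain ⟨U, hUS, hUc, hUZ, hUb, hUn⟩ : ∃ U ⊆ σ ∩ W, #U = e + 3 ∧ U ∉ Z ∧
          (∀ x ∈ U, U.erase x ∈ Z) ∧
          boundary V (Finsupp.single U 1) ∉ boundaries (induced Z (σ ∩ W)) (e + 1) := by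
        cases e with
        | zero =>
          obtain ⟨n, v, hv, hvS, hvn⟩ := hcyc (by omega) (σ ∩ W) _ hc hn
          exact exists_missing_triangle hu Finset.inter_subset_left hv hvS hvn
        | succ e => exact ih e (by omega) (σ ∩ W) _ hc hn
      have hUcyc : boundary V (Finsupp.single U 1) ∈ cycles (induced Z (σ ∩ W)) (e + 1) :=
        boundary_single_mem_cycles hUc fun x hx => ⟨hUb x hx, (Finset.erase_subset x U).trans hUS⟩
      have hle : induced Z (σ ∩ W) ≤ induced Z W :=
        fun F hF => ⟨hF.1, hF.2.trans Finset.inter_subset_right⟩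
      -- By uniqueness `∂U` is homologous to `boundary V a` in `Z[σ ∩ W]`, and the latter bounds in
      -- `Z[W]` because `a` lies there.
      have hUW : boundary V (Finsupp.single U 1) ∈ boundaries (induced Z W) (e + 1) :=
        (add_mem_cancel_left (boundary_mem_boundaries ha)).1 (boundaries_mono hle _
          (hadd e (by omega) (σ ∩ W) _ _ hc hn hUcyc hUn))
      obtain ⟨w, hw, hwU⟩ := happ e (by omega) U W (hUS.trans Finset.inter_subset_right) hUc hUZ
        hUb hUW
      exact exists_missing_face_attach hUS hUc hUZ hUn hw hwU

end WeakShell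

namespace WeakShell

variable {V : Type*}

/-! ### Generators and the Leray number -/

theorem IsFacetOrder.unionOf_eq [Fintype V] {X : Cx V} {l : List (Finset V)} (h : IsFacetOrder X l) :
    unionOf l = X := by
  ext F
  constructor
  · rintro ⟨σ, hσ, hF⟩
    exact X.lower hF ((h.2 σ).1 hσ).prop
  · intro hF
    obtain ⟨σ, hFσ, hσ⟩ := (Set.toFinite (X : Set (Finset V))).exists_le_maximal hF
    exact ⟨σ, (h.2 σ).2 hσ, hFσ⟩

theorem faceSum_eq_sum [Fintype V] {ι : Type*} {Y : Cx V} {n : ℕ} (s : Finset ι) (f : ι → Finset V)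
    (hf : Set.InjOn f s) (h : ∀ F, (F ∈ Y ∧ #F = n + 1) ↔ ∃ i ∈ s, f i = F) :
    faceSum Y n = ∑ i ∈ s, Finsupp.single (f i) 1 := by
  classical
  rw [faceSum, ← Finset.sum_image (f := fun F => (Finsupp.single F 1 : Finset V →₀ ZMod 2)) hf]
  refine Finset.sum_congr ?_ fun _ _ => rfl
  ext F
  simp only [Finset.mem_filter, Finset.mem_univ, true_and, Finset.mem_image]
  exact h F

variable [DecidableEq V]

/-- Over `ℤ/2` every class is zero or equal to that of `z`. -/
theorem exists_smul_eq_of_unique {X : Cx V} {n : ℕ} {z : Finset V →₀ ZMod 2} (hz : z ∈ cycles X n)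
    (h : ∀ y ∈ cycles X n, y ∉ boundaries X n → z + y ∈ boundaries X n) (w : Homology X n) :
    ∃ c : ZMod 2, c • homologyClass X n ⟨z, hz⟩ = w := by
  obtain ⟨⟨y, hy⟩, rfl⟩ := Submodule.Quotient.mk_surjective _ w
  by_cases hyb : y ∈ boundaries X n
  · refine ⟨0, ?_⟩
    rw [zero_smul, eq_comm, Submodule.Quotient.mk_eq_zero]
    exact hyb
  · refine ⟨1, ?_⟩
    rw [one_smul, Submodule.Quotient.eq]
    change z - y ∈ boundaries X n
    rw [ZModModule.sub_eq_add]
    exact h y hy hyb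

theorem betti_le_one {X : Cx V} {n : ℕ}
    (h : ∀ z₁ z₂, z₁ ∈ cycles X n → z₁ ∉ boundaries X n → z₂ ∈ cycles X n → z₂ ∉ boundaries X n →
      z₁ + z₂ ∈ boundaries X n) : betti X n ≤ 1 := by
  by_cases hX : ∃ z ∈ cycles X n, z ∉ boundaries X n
  · obtain ⟨z, hz, hzn⟩ := hX
    exact finrank_le_one _ (exists_smul_eq_of_unique hz fun y hy hyn => h z y hz hzn hy hyn)
  · have : Subsingleton (Homology X n) := by
      rw [← not_nontrivial_iff_subsingleton, nontrivial_homology_iff]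
      exact hX
    rw [betti, Module.finrank_zero_of_subsingleton]
    exact zero_le_one

theorem lerayNumber_eq_zero_of_isSimplex {X : Cx V} (h : IsSimplex X) : lerayNumber X = 0 :=
  Nat.sInf_eq_zero.2 (Or.inl fun i _ W =>
    subsingleton_homology_iff.2 ((h.induced W).isAcyclicAt i))

/-- Minimality gives a nonzero class in some degree at least `k - 1`; as `X` is `k`-Leray, the
degree is exactly `k - 1`. -/
theorem exists_nontrivial_homology {X : Cx V} {k : ℕ} (hk : 1 ≤ k) (h : lerayNumber X = k) :
    ∃ W : Finset V, Nontrivial (Homology (induced X W) (k - 1)) := by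
  have hmem : IsLeray X k := h ▸ Nat.sInf_mem (Nat.nonempty_of_pos_sInf (by
    change 0 < lerayNumber X
    omega))
  have hnot : ¬ IsLeray X (k - 1) := Nat.notMem_of_lt_sInf (by
    change k - 1 < lerayNumber X
    omega)
  simp only [IsLeray, not_forall] at hnot
  obtain ⟨i, hi, W, hW⟩ := hnot
  rw [not_subsingleton_iff_nontrivial] at hW
  rcases hi.eq_or_lt with rfl | hlt
  · exact ⟨W, hW⟩
  · exact absurd (hmem i (by omega) W) (not_subsingleton_iff_nontrivial.2 hW)

theorem edge_injective {n : ℕ} {v : Fin (n + 3) → V} (hv : Function.Injective v) :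
    Function.Injective fun i => ({v i, v (i + 1)} : Finset V) := by
  intro i j hij
  dsimp only at hij
  have hi : v i ∈ ({v j, v (j + 1)} : Finset V) := hij ▸ Finset.mem_insert_self _ _
  have hi' : v (i + 1) ∈ ({v j, v (j + 1)} : Finset V) := hij ▸ by simp
  simp only [Finset.mem_insert, Finset.mem_singleton, hv.eq_iff] at hi hi'
  rcases hi with h | rfl
  · exact h
  · rcases hi' with h | h
    · have h2 : j + (1 + 1) = j + 0 := by rw [← add_assoc, h, add_zero]
      have h3 := congrArg Fin.val (add_left_cancel h2)
      simp [Fin.val_add, Nat.mod_eq_of_lt] at h3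
    · exact absurd h.symm (ne_add_one _)

variable [Fintype V]

theorem faceSum_simplexBoundary {U : Finset V} {n : ℕ} (hU : #U = n + 2) :
    faceSum (simplexBoundary U) n = boundary V (Finsupp.single U 1) := by
  rw [boundary_single]
  refine faceSum_eq_sum U U.erase (Finset.erase_injOn U) fun F => ⟨?_, ?_⟩
  · rintro ⟨hFU, hF⟩
    have hFU' : F ⊂ U := hFU
    obtain ⟨x, hx, hxF⟩ := Finset.exists_of_ssubset hFU'
    refine ⟨x, hx, (Finset.eq_of_subset_of_card_le (Finset.subset_erase.2 ⟨hFU'.1, hxF⟩) ?_).symm⟩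
    rw [Finset.card_erase_of_mem hx]
    omega
  · rintro ⟨x, hx, rfl⟩
    refine ⟨Finset.erase_ssubset hx, ?_⟩
    rw [Finset.card_erase_of_mem hx]
    omega

theorem faceSum_of_faces_iff {Y : Cx V} {n : ℕ} {v : Fin (n + 3) → V} (hv : Function.Injective v)
    (hY : ∀ F, F ∈ Y ↔ ∃ i, F ⊆ {v i, v (i + 1)}) : faceSum Y 1 = edgeSum v := by
  have hcard : ∀ i, #({v i, v (i + 1)} : Finset V) = 2 :=
    fun i => Finset.card_pair fun h => ne_add_one i (hv h)
  refine faceSum_eq_sum Finset.univ (fun i => {v i, v (i + 1)}) (edge_injective hv).injOn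
    fun F => ⟨?_, ?_⟩
  · rintro ⟨hF, hFc⟩
    obtain ⟨i, hi⟩ := (hY F).1 hF
    refine ⟨i, Finset.mem_univ i, (Finset.eq_of_subset_of_card_le hi ?_).symm⟩
    rw [hcard, hFc]
  · rintro ⟨i, -, rfl⟩
    exact ⟨(hY _).2 ⟨i, subset_rfl⟩, hcard i⟩

theorem givesGenerator_of_faceSum {Y X : Cx V} {n : ℕ} {z : Finset V →₀ ZMod 2}
    (hYz : faceSum Y n = z) (hz : z ∈ cycles X n)
    (h : ∀ y ∈ cycles X n, y ∉ boundaries X n → z + y ∈ boundaries X n) :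
    GivesGenerator Y X n := by
  subst hYz
  refine ⟨hz, eq_top_iff.2 fun w _ => ?_⟩
  exact Submodule.mem_span_singleton.2 (exists_smul_eq_of_unique hz h w)

theorem exists_isCycle_generator {l : List (Finset V)} (hl : WeakShellingOrder l)
    (hM : orderM l = 2) (W : Finset V) (hW : Nontrivial (Homology (induced (unionOf l) W) 1)) :
    ∃ U ⊆ W, IsCycle (induced (induced (unionOf l) W) U) ∧
      GivesGenerator (induced (induced (unionOf l) W) U) (induced (unionOf l) W) 1 := by
  obtain ⟨z, hz, hzn⟩ := nontrivial_homology_iff.1 hW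
  obtain ⟨n, v, hv, hvW, hvn⟩ := exists_inducedCycle l hl hM W z hz hzn
  have hUW : Finset.univ.image v ⊆ W := by
    intro x hx
    obtain ⟨i, -, rfl⟩ := Finset.mem_image.1 hx
    exact hvW i
  have hfaces : ∀ F, F ∈ induced (induced (unionOf l) W) (Finset.univ.image v) ↔
      ∃ i, F ⊆ {v i, v (i + 1)} := by
    intro F
    constructor
    · rintro ⟨⟨h1, -⟩, h2⟩
      exact (hv.2 F h2).1 h1
    · rintro ⟨i, hi⟩
      have hFU : F ⊆ Finset.univ.image v := hi.trans (by simp [Finset.insert_subset_iff])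
      exact ⟨⟨(hv.2 F hFU).2 ⟨i, hi⟩, hFU.trans hUW⟩, hFU⟩
  have hcyc : edgeSum v ∈ cycles (induced (unionOf l) W) 1 :=
    edgeSum_mem_cycles hv.1 fun i => ((hfaces _).2 ⟨i, subset_rfl⟩).1
  exact ⟨_, hUW, ⟨n, v, hv.1, hfaces⟩, givesGenerator_of_faceSum (faceSum_of_faces_iff hv.1 hfaces)
    hcyc fun y hy hyn => add_mem_boundaries_of_orderM l hl 0 hM W _ y hcyc hvn hy hyn⟩

theorem exists_simplexBoundary_generator {l : List (Finset V)} (hl : WeakShellingOrder l) {e : ℕ}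
    (hM : orderM l = e + 3) (W : Finset V)
    (hW : Nontrivial (Homology (induced (unionOf l) W) (e + 2))) :
    ∃ U ⊆ W, #U = e + 4 ∧ induced (induced (unionOf l) W) U = simplexBoundary U ∧
      GivesGenerator (induced (induced (unionOf l) W) U) (induced (unionOf l) W) (e + 2) := by
  obtain ⟨z, hz, hzn⟩ := nontrivial_homology_iff.1 hW
  obtain ⟨U, hUW, hUc, hUX, hUb, hUn⟩ := exists_missing_face l hl e hM W z hz hzn
  have hcyc : boundary V (Finsupp.single U 1) ∈ cycles (induced (unionOf l) W) (e + 2) :=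
    boundary_single_mem_cycles hUc fun x hx => ⟨hUb x hx, (Finset.erase_subset x U).trans hUW⟩
  have hU : induced (induced (unionOf l) W) U = simplexBoundary U := by
    ext F
    constructor
    · rintro ⟨⟨h1, -⟩, h2⟩
      exact lt_of_le_of_ne (show F ≤ U from h2) fun h => hUX (h ▸ h1)
    · intro hF
      have hFU : F ⊂ U := hF
      obtain ⟨x, hx, hxF⟩ := Finset.exists_of_ssubset hFU
      exact ⟨⟨(unionOf l).lower (Finset.subset_erase.2 ⟨hFU.1, hxF⟩) (hUb x hx),
        hFU.1.trans hUW⟩, hFU.1⟩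
  refine ⟨U, hUW, hUc, hU, ?_⟩
  rw [hU]
  exact givesGenerator_of_faceSum (faceSum_simplexBoundary hUc) hcyc fun y hy hyn =>
    add_mem_boundaries_of_orderM l hl (e + 1) hM W _ y hcyc hUn hy hyn

end WeakShell

theorem theorem4p1 {V : Type*} [Fintype V] [DecidableEq V] (X : Cx V)
    (hX : (X : Set (Finset V)).Nonempty)
    (hLM : lerayNumber X = facetM X)
    (hshell : ∃ l : List (Finset V), IsWeakShelling X l ∧ orderM l = facetM X) :
    (lerayNumber X = 1 ↔ facetM X = 1 ∧ ¬ IsSimplex X) ∧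
    ((lerayNumber X = 2 ↔
        facetM X = 2 ∧ ∃ W : Finset V, Nontrivial (Homology (induced X W) 1)) ∧
      (lerayNumber X = 2 → ∀ W : Finset V, Nontrivial (Homology (induced X W) 1) →
        ∃ U ⊆ W, IsCycle (induced (induced X W) U) ∧
          GivesGenerator (induced (induced X W) U) (induced X W) 1)) ∧
    (∀ k : ℕ, 3 ≤ k →
      (lerayNumber X = k ↔
        facetM X = k ∧ ∃ W : Finset V, Nontrivial (Homology (induced X W) (k - 1))) ∧
      (lerayNumber X = k → ∀ W : Finset V, Nontrivial (Homology (induced X W) (k - 1)) →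
        ∃ U ⊆ W, #U = k + 1 ∧ induced (induced X W) U = simplexBoundary U ∧
          GivesGenerator (induced (induced X W) U) (induced X W) (k - 1))) ∧
    (∀ k : ℕ, 2 ≤ k → lerayNumber X = k → ∀ W : Finset V, betti (induced X W) (k - 1) ≤ 1) := by
  obtain ⟨l, ⟨hord, hl⟩, hM⟩ := hshell
  -- With `M(X)` replaced by `L(X)` the converse implications become projections.
  rw [← hLM] at hM ⊢
  have hXl := hord.unionOf_eq
  refine ⟨⟨fun h => ⟨h, fun hs => ?_⟩, And.left⟩,
    ⟨⟨fun h => ⟨h, exists_nontrivial_homology (k := 2) (by omega) h⟩, And.left⟩,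
      fun h W hW => ?_⟩,
    fun k hk => ⟨⟨fun h => ⟨h, exists_nontrivial_homology (by omega) h⟩, And.left⟩,
      fun h W hW => ?_⟩,
    fun k hk h W => betti_le_one fun z₁ z₂ => ?_⟩
  · rw [lerayNumber_eq_zero_of_isSimplex hs] at h
    exact zero_ne_one h
  · rw [← hXl] at hW ⊢
    exact exists_isCycle_generator hl (hM.trans h) W hW
  · obtain ⟨e, rfl⟩ := Nat.exists_eq_add_of_le' hk
    rw [← hXl] at hW ⊢
    exact exists_simplexBoundary_generator hl (hM.trans h) W hW
  · obtain ⟨e, rfl⟩ := Nat.exists_eq_add_of_le' hk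
    rw [← hXl]
    exact add_mem_boundaries_of_orderM l hl e (hM.trans h) W z₁ z₂
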